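/- All manifolds and maps are smooth. An immersion $f\colon M\to\mathbb R^N$ of a manifold $M$ (possibly with boundary) is called scalar positive if the Riemannian metric induced on $M$ by $f$ has positive scalar curvature at every point. Let $B$ be a compact $\ell$-dimensional manifold, possibly with boundary, and let $E\to B$ be a Euclidean vector bundle of rank $m$. Let $X\subset\mathbb R^m$ be a compact submanifold (without boundary), with induced Riemannian metric $h$, and let $V\subset E$ be a sub-fibre bundle of $E\to B$ with fibre $X$ such that around each point of $B$ there are an open set $U\subset B$ and an orthogonal vector bundle trivialization $\Psi\colon E|_U\to U\times\mathbb R^m$ with $\Psi(V\cap E|_U)=U\times X$. Suppose that the scalar curvature of $h$ is everywhere positive and that there exists an immersion $F\colon E\to\mathbb R^N$ of the total space. Then there exists a scalar positive immersion $f\colon V\to\mathbb R^N$. -/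

import Mathlib

open Bundle
open scoped Manifold ContDiff

noncomputable section

/-! ### Scalar curvature of a metric in coordinates

`𝓔` is the coordinate vector space with basis `b`, and `S ⊆ 𝓔` is the set on which the coordinates
take their values (the whole space, a half space, …); derivatives are taken within `S`.  The metric
is given by its values `G x v w`. -/

section Coordinates

variable {𝓔 : Type*} [NormedAddCommGroup 𝓔] [NormedSpace ℝ 𝓔]
  {ι : Type*} [Fintype ι] [DecidableEq ι] (b : Module.Basis ι ℝ 𝓔) (S : Set 𝓔)
  (G : 𝓔 → LinearMap.BilinForm ℝ 𝓔)

/-- The partial derivative `∂ᵢ u` at `x`. -/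
def coordDeriv (i : ι) (u : 𝓔 → ℝ) (x : 𝓔) : ℝ :=
  fderivWithin ℝ u S x (b i)

/-- The metric coefficients `g_{ij}`. -/
def metricCoeff (x : 𝓔) : Matrix ι ι ℝ :=
  Matrix.of fun i j => G x (b i) (b j)

/-- The Christoffel symbols
`Γ^k_{ij} = ½ ∑_l g^{kl} (∂_i g_{jl} + ∂_j g_{il} - ∂_l g_{ij})`. -/
def christoffel (k i j : ι) (x : 𝓔) : ℝ :=
  (1 / 2 : ℝ) * ∑ l, (metricCoeff b G x)⁻¹ k l *
    (coordDeriv b S i (fun y => metricCoeff b G y j l) x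
      + coordDeriv b S j (fun y => metricCoeff b G y i l) x
      - coordDeriv b S l (fun y => metricCoeff b G y i j) x)

/-- The components of the curvature tensor: `R(∂_i, ∂_j) ∂_k = ∑_l R^l_{kij} ∂_l` with
`R(X, Y) = ∇_X ∇_Y - ∇_Y ∇_X - ∇_{[X, Y]}`. -/
def riemannCoeff (l k i j : ι) (x : 𝓔) : ℝ :=
  coordDeriv b S i (christoffel b S G l j k) x - coordDeriv b S j (christoffel b S G l i k) x
    + ∑ m, (christoffel b S G l i m x * christoffel b S G m j k x
      - christoffel b S G l j m x * christoffel b S G m i k x)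

/-- The Ricci tensor `Ric_{jk} = ∑_i R^i_{kij}`. -/
def ricciCoeff (j k : ι) (x : 𝓔) : ℝ :=
  ∑ i, riemannCoeff b S G i k i j x

/-- The scalar curvature `∑_{j,k} g^{jk} Ric_{jk}` (equal to `2` on the unit sphere in `ℝ³`). -/
def coordScalarCurvature (x : 𝓔) : ℝ :=
  ∑ j, ∑ k, (metricCoeff b G x)⁻¹ j k * ricciCoeff b S G j k x

end Coordinates

/-! ### Scalar curvature on manifolds, and scalar positive immersions -/

section Manifolds

variable {𝓔 : Type*} [NormedAddCommGroup 𝓔] [NormedSpace ℝ 𝓔]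
  {H : Type*} [TopologicalSpace H] (I : ModelWithCorners ℝ 𝓔 H)
  {M : Type*} [TopologicalSpace M] [ChartedSpace H M]

/-- The metric `g` in the chart of `M` around `p`: the pull back of `g` under the inverse of the
chart. -/
def metricInChart (g : ∀ q : M, LinearMap.BilinForm ℝ (TangentSpace I q)) (p : M) (x : 𝓔) :
    LinearMap.BilinForm ℝ 𝓔 :=
  let A : 𝓔 →L[ℝ] TangentSpace I ((extChartAt I p).symm x) :=
    mfderivWithin 𝓘(ℝ, 𝓔) I (extChartAt I p).symm (Set.range I) x
  (g ((extChartAt I p).symm x)).compl₁₂ A.toLinearMap A.toLinearMap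

/-- The scalar curvature at `p` of a Riemannian metric `g` on a manifold `M`, possibly with
boundary, computed in the chart of `M` around `p`. -/
def scalarCurvature [FiniteDimensional ℝ 𝓔]
    (g : ∀ q : M, LinearMap.BilinForm ℝ (TangentSpace I q)) (p : M) : ℝ :=
  coordScalarCurvature (Module.finBasis ℝ 𝓔) (Set.range I) (metricInChart I g p) (extChartAt I p p)

/-- A smooth map between (finite dimensional) manifolds, possibly with boundary, is an immersion if
its differential is injective at every point. -/
structure IsSmoothImmersion {𝓔' : Type*} [NormedAddCommGroup 𝓔'] [NormedSpace ℝ 𝓔']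
    {H' : Type*} [TopologicalSpace H'] (I' : ModelWithCorners ℝ 𝓔' H')
    {M' : Type*} [TopologicalSpace M'] [ChartedSpace H' M'] (f : M → M') : Prop where
  contMDiff : ContMDiff I I' ∞ f
  injective_mfderiv : ∀ p : M, Function.Injective (mfderiv I I' f p)

variable {W : Type*} [NormedAddCommGroup W] [InnerProductSpace ℝ W]

/-- The metric induced on `M` by a map `f` into a Euclidean space:
`(v, w) ↦ ⟪df(v), df(w)⟫`. -/
def inducedMetric (f : M → W) (q : M) : LinearMap.BilinForm ℝ (TangentSpace I q) :=
  let A : TangentSpace I q →L[ℝ] W := mfderiv I 𝓘(ℝ, W) f q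
  (innerₗ W).compl₁₂ A.toLinearMap A.toLinearMap

/-- The metric induced on `M` by `f` has positive scalar curvature. -/
def HasPositiveInducedScal [FiniteDimensional ℝ 𝓔] (f : M → W) : Prop :=
  ∀ p : M, 0 < scalarCurvature I (inducedMetric I f) p

/-- An immersion into a Euclidean space is scalar positive if the metric induced by it has positive
scalar curvature. -/
structure IsScalarPositiveImmersion [FiniteDimensional ℝ 𝓔] (f : M → W) : Prop where
  isSmoothImmersion : IsSmoothImmersion I 𝓘(ℝ, W) f
  hasPositiveInducedScal : HasPositiveInducedScal I f

end Manifolds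

/-! ### Sub-fibre bundles of Euclidean vector bundles -/

section Bundles

variable {𝓔 : Type*} [NormedAddCommGroup 𝓔] [NormedSpace ℝ 𝓔]
  {H : Type*} [TopologicalSpace H] (I : ModelWithCorners ℝ 𝓔 H)
  {B : Type*} [TopologicalSpace B] [ChartedSpace H B]
  {F : Type*} [NormedAddCommGroup F] [InnerProductSpace ℝ F]
  {E : B → Type*} [TopologicalSpace (TotalSpace F E)]
  [∀ x, NormedAddCommGroup (E x)] [∀ x, InnerProductSpace ℝ (E x)]
  [FiberBundle F E]

/-- A smooth local trivialization `E|_U ≅ U × F` that is a linear isometry on every fibre. -/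
structure IsOrthogonalTrivialization (e : Trivialization F (π F E)) : Prop where
  contMDiffOn : ContMDiffOn (I.prod 𝓘(ℝ, F)) (I.prod 𝓘(ℝ, F)) ∞ e e.source
  contMDiffOn_symm : ContMDiffOn (I.prod 𝓘(ℝ, F)) (I.prod 𝓘(ℝ, F)) ∞
    e.toOpenPartialHomeomorph.symm e.target
  isLinear : e.IsLinear ℝ
  inner_eq : ∀ x ∈ e.baseSet, ∀ v w : E x,
    inner ℝ (e (TotalSpace.mk' F x v)).2 (e (TotalSpace.mk' F x w)).2 = inner ℝ v w

/-- `V` is a sub-fibre bundle of `E` with fibre `X ⊆ F`: around every point of the base there is an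
orthogonal trivialization `E|_U ≅ U × F` that maps `V ∩ E|_U` onto `U × X`. -/
def IsSubFibreBundle (V : Set (TotalSpace F E)) (X : Set F) : Prop :=
  ∀ x : B, ∃ e : Trivialization F (π F E), x ∈ e.baseSet ∧ IsOrthogonalTrivialization I e ∧
    e '' (V ∩ e.source) = e.baseSet ×ˢ X

end Bundles

end

/-!
The immersion is `v ↦ F (ε • A v)` for a small `ε > 0`, where `A` is a suitable positive operator
on the fibres of `E`.

Along the zero section, let `N` be the derivative of `F` in the fibre direction followed by the
orthogonal projection to the complement of the derivative of `F` along the zero section. It is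
injective because `F` is an immersion, and `A = (Nᵀ N)^{-1/2}` is the positive operator for which
`N ∘ A` is isometric (`normalizer`). Uniqueness of the square root makes `A` independent of the
orthogonal trivialization in which it is computed (`scaledPoint_congr`), and a square root of a
positive operator depends smoothly on it (`ContDiffWithinAt.normalizer`); so `F (ε • A v)` is
smooth.

By the Gauss equation, the scalar curvature of the metric induced by a map into a Euclidean space
is an algebraic expression in its first and second derivatives
(`coordScalarCurvature_eq_gaussScal`), which does not depend on the choice of coordinates
(`jetScal_comp`, `scalarCurvature_eq_jetScal_of_comp`). In coordinates `(x, y)` of `V`, where `φ`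
parametrizes `X`, the map is `Φ (x, ε • φ y)`. Take its derivatives with respect to the
vectors `∂ₓ` and `ε⁻¹ ∂_y`. The first derivatives then converge to `(a, z) ↦ L a + M (φ'(y) z)`,
where `L` and `M` are the derivatives of `Φ` in the base and fibre directions, and, after
multiplication by `ε`, of the second derivatives only `M (φ''(y))` survives. The limit is the jet
of a cylinder, whose expression is that of `X` because `M`, projected to the complement of the
range of `L`, is isometric (`jetScal_cylinder`). Hence `ε²` times the scalar curvature converges
to the scalar curvature of `X`, which is positive (`eventually_shrink_scalar_pos`). This holds
locally uniformly on `V`, and `V` is compact, so a single `ε` serves everywhere.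
-/

set_option linter.unusedSectionVars false

noncomputable section

/-! ### The scalar curvature of an immersion by the Gauss equation -/

section GaussEquation

open Filter Topology Matrix

variable {W : Type*} [NormedAddCommGroup W] [InnerProductSpace ℝ W]
  {ι : Type*} [Fintype ι] [DecidableEq ι]

/-- The component of `w` orthogonal to the span of the linearly independent family `d`, written with
the inverse Gram matrix. -/
def normalPart (d : ι → W) (w : W) : W :=
  w - ∑ k, (∑ l, (gram ℝ d)⁻¹ k l * inner ℝ w (d l)) • d k

/-- The right-hand side of the Gauss equation for the scalar curvature of an immersion into a
Euclidean space, with first partial derivatives `d i` and second partial derivatives `s i j`. -/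
def gaussScal (d : ι → W) (s : ι → ι → W) : ℝ :=
  ∑ j, ∑ k, (gram ℝ d)⁻¹ j k * ∑ i, ∑ p, (gram ℝ d)⁻¹ i p *
    (inner ℝ (normalPart d (s j k)) (normalPart d (s i p))
      - inner ℝ (normalPart d (s i k)) (normalPart d (s j p)))

lemma isUnit_det_gram {d : ι → W} (hd : LinearIndependent ℝ d) : IsUnit (gram ℝ d).det :=
  isUnit_iff_ne_zero.2 (det_gram_ne_zero_iff_linearIndependent.2 hd)

lemma inner_normalPart_left {d : ι → W} (hd : IsUnit (gram ℝ d).det) (w : W) (p : ι) :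
    inner ℝ (normalPart d w) (d p) = 0 := by
  have h : ∀ l, ∑ k, (gram ℝ d)⁻¹ k l * gram ℝ d k p = if l = p then 1 else 0 := by
    intro l
    have h1 : ((gram ℝ d)⁻¹ᵀ * gram ℝ d) l p = (1 : Matrix ι ι ℝ) l p := by
      rw [transpose_nonsing_inv]
      have : (gram ℝ d)ᵀ = gram ℝ d := by
        ext i j; simp [gram_apply, real_inner_comm]
      rw [this, nonsing_inv_mul _ hd]
    simpa [mul_apply, one_apply] using h1
  simp only [normalPart, inner_sub_left, sum_inner, inner_smul_left, RCLike.conj_to_real]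
  have : ∑ k, (∑ l, (gram ℝ d)⁻¹ k l * inner ℝ w (d l)) * inner ℝ (d k) (d p)
      = ∑ l, inner ℝ w (d l) * ∑ k, (gram ℝ d)⁻¹ k l * gram ℝ d k p := by
    simp only [Finset.sum_mul, Finset.mul_sum, gram_apply]
    rw [Finset.sum_comm]
    exact Finset.sum_congr rfl fun l _ => Finset.sum_congr rfl fun k _ => by ring
  rw [this]
  simp only [h, mul_ite, mul_one, mul_zero, Finset.sum_ite_eq', Finset.mem_univ, if_true, sub_self]

lemma inner_normalPart_span {d : ι → W} (hd : IsUnit (gram ℝ d).det) (w : W) {y : W}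
    (hy : y ∈ Submodule.span ℝ (Set.range d)) : inner ℝ (normalPart d w) y = 0 := by
  induction hy using Submodule.span_induction with
  | mem x hx =>
    obtain ⟨p, rfl⟩ := hx
    exact inner_normalPart_left hd w p
  | zero => simp
  | add x y _ _ hx hy => rw [inner_add_right, hx, hy, add_zero]
  | smul c x _ hx => rw [inner_smul_right, hx, mul_zero]

lemma sub_normalPart_mem (d : ι → W) (w : W) :
    w - normalPart d w ∈ Submodule.span ℝ (Set.range d) := by
  simp only [normalPart, sub_sub_cancel]
  exact Submodule.sum_mem _ fun k _ => Submodule.smul_mem _ _ (Submodule.subset_span ⟨k, rfl⟩)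

/-- The normal part is characterized by orthogonality to the span of `d` and by differing from `w`
by an element of that span. -/
lemma normalPart_eq_of {d : ι → W} (hd : IsUnit (gram ℝ d).det) {w n : W}
    (h1 : w - n ∈ Submodule.span ℝ (Set.range d)) (h2 : ∀ p, inner ℝ n (d p) = 0) :
    normalPart d w = n := by
  have h3 : normalPart d w - n ∈ Submodule.span ℝ (Set.range d) := by
    have := Submodule.sub_mem _ h1 (sub_normalPart_mem d w)
    simpa using this
  have h4 : ∀ y ∈ Submodule.span ℝ (Set.range d), inner ℝ n y = 0 := by
    intro y hy
    induction hy using Submodule.span_induction with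
    | mem x hx => obtain ⟨p, rfl⟩ := hx; exact h2 p
    | zero => simp
    | add x y _ _ hx hy => rw [inner_add_right, hx, hy, add_zero]
    | smul c x _ hx => rw [inner_smul_right, hx, mul_zero]
  have h5 : inner ℝ (normalPart d w - n) (normalPart d w - n) = 0 := by
    rw [inner_sub_left, inner_normalPart_span hd _ h3, h4 _ h3, sub_zero]
  exact sub_eq_zero.1 (inner_self_eq_zero.1 h5)

variable {𝓔 : Type*} [NormedAddCommGroup 𝓔] [NormedSpace ℝ 𝓔]
  {𝓕 : Type*} [NormedAddCommGroup 𝓕] [NormedSpace ℝ 𝓕] (b : Module.Basis ι ℝ 𝓔) {S : Set 𝓔}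

lemma fderivWithin_inner_apply {f g : 𝓔 → W} {x : 𝓔} (hS : UniqueDiffWithinAt ℝ S x)
    (hf : DifferentiableWithinAt ℝ f S x) (hg : DifferentiableWithinAt ℝ g S x) (v : 𝓔) :
    fderivWithin ℝ (fun y => inner ℝ (f y) (g y)) S x v =
      inner ℝ (f x) (fderivWithin ℝ g S x v) + inner ℝ (fderivWithin ℝ f S x v) (g x) := by
  rw [(hf.hasFDerivWithinAt.inner ℝ hg.hasFDerivWithinAt).fderivWithin hS]
  simp [fderivInnerCLM_apply]

lemma ContDiffWithinAt.fderivWithin_apply_const {f : 𝓔 → 𝓕} {x : 𝓔} {n m : ℕ∞ω}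
    (hf : ContDiffWithinAt ℝ n f S x) (hS : UniqueDiffOn ℝ S) (hx : x ∈ S) (hmn : m + 1 ≤ n)
    (v : 𝓔) : ContDiffWithinAt ℝ m (fun y => fderivWithin ℝ f S y v) S x :=
  (hf.fderivWithin_right hS hmn hx).clm_apply contDiffWithinAt_const

lemma fderivWithin_fderivWithin_apply {f : 𝓔 → 𝓕} {x : 𝓔}
    (hf : ContDiffWithinAt ℝ 2 f S x) (hS : UniqueDiffOn ℝ S) (hx : x ∈ S) (v w : 𝓔) :
    fderivWithin ℝ (fun y => fderivWithin ℝ f S y w) S x v =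
      fderivWithin ℝ (fderivWithin ℝ f S) S x v w := by
  have h : DifferentiableWithinAt ℝ (fderivWithin ℝ f S) S x :=
    (hf.fderivWithin_right (m := 1) hS (by norm_num [one_add_one_eq_two]) hx).differentiableWithinAt
      one_ne_zero
  rw [fderivWithin_clm_apply (hS x hx) h (differentiableWithinAt_const _)]
  simp

lemma fderivWithin_fderivWithin_comm {f : 𝓔 → W} {x : 𝓔}
    (hf : ContDiffWithinAt ℝ 2 f S x) (hS : UniqueDiffOn ℝ S) (hS' : S ⊆ closure (interior S))
    (hx : x ∈ S) (v w : 𝓔) :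
    fderivWithin ℝ (fun y => fderivWithin ℝ f S y w) S x v =
      fderivWithin ℝ (fun y => fderivWithin ℝ f S y v) S x w := by
  rw [fderivWithin_fderivWithin_apply hf hS hx, fderivWithin_fderivWithin_apply hf hS hx]
  exact (hf.isSymmSndFDerivWithinAt (by simp) hS (hS' hx) hx).eq v w

lemma ContDiffWithinAt.matrix_det {A : 𝓔 → Matrix ι ι ℝ} {n : ℕ∞ω} {x : 𝓔}
    (hA : ∀ i j, ContDiffWithinAt ℝ n (fun y => A y i j) S x) :
    ContDiffWithinAt ℝ n (fun y => (A y).det) S x := by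
  simp only [det_apply]
  exact ContDiffWithinAt.sum fun σ _ => (contDiffWithinAt_prod fun i _ => hA _ _).const_smul _

lemma ContDiffWithinAt.matrix_inv {A : 𝓔 → Matrix ι ι ℝ} {n : ℕ∞ω} {x : 𝓔}
    (hA : ∀ i j, ContDiffWithinAt ℝ n (fun y => A y i j) S x) (hx : IsUnit (A x).det) (i j : ι) :
    ContDiffWithinAt ℝ n (fun y => (A y)⁻¹ i j) S x := by
  have h : (fun y => (A y)⁻¹ i j) =
      fun y => (A y).det⁻¹ * ((A y).updateRow j (Pi.single i 1)).det := by
    ext y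
    rw [inv_def, Matrix.smul_apply, Ring.inverse_eq_inv', adjugate_apply, smul_eq_mul]
  rw [h]
  refine ContDiffWithinAt.mul ((ContDiffWithinAt.matrix_det hA).inv hx.ne_zero)
    (ContDiffWithinAt.matrix_det fun k l => ?_)
  simp only [updateRow_apply]
  split_ifs
  · exact contDiffWithinAt_const
  · exact hA k l

/-- The Gauss equation: the scalar curvature of the metric induced by `f`, computed from the
Christoffel symbols, is given by the second fundamental form of `f`. -/
theorem coordScalarCurvature_eq_gaussScal (hS : UniqueDiffOn ℝ S)
    (hS' : S ⊆ closure (interior S)) {f : 𝓔 → W} {x : 𝓔} (hx : x ∈ S)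
    (hf : ContDiffWithinAt ℝ 3 f S x)
    (hd : LinearIndependent ℝ fun i => fderivWithin ℝ f S x (b i))
    {G : 𝓔 → LinearMap.BilinForm ℝ 𝓔}
    (hG : ∀ᶠ y in 𝓝[S] x, ∀ v w,
      G y v w = inner ℝ (fderivWithin ℝ f S y v) (fderivWithin ℝ f S y w)) :
    coordScalarCurvature b S G x =
      gaussScal (fun i => fderivWithin ℝ f S x (b i))
        fun i j => fderivWithin ℝ (fderivWithin ℝ f S) S x (b i) (b j) := by
  set F : ι → 𝓔 → W := fun i y => fderivWithin ℝ f S y (b i) with hF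
  set A : ι → ι → 𝓔 → W := fun i j y => fderivWithin ℝ (F j) S y (b i) with hA
  have e3 : ∀ᶠ y in 𝓝[S] x, ContDiffWithinAt ℝ 3 f S y := by
    simpa [Set.insert_eq_of_mem hx] using hf.eventually (by decide)
  have eS : ∀ᶠ y in 𝓝[S] x, y ∈ S := self_mem_nhdsWithin
  have cF : ∀ {y}, y ∈ S → ContDiffWithinAt ℝ 3 f S y → ∀ i, ContDiffWithinAt ℝ 2 (F i) S y :=
    fun hy h i => h.fderivWithin_apply_const hS hy (by norm_num [two_add_one_eq_three]) _
  have cA : ∀ {y}, y ∈ S → ContDiffWithinAt ℝ 3 f S y → ∀ i j, ContDiffWithinAt ℝ 1 (A i j) S y :=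
    fun hy h i j => (cF hy h j).fderivWithin_apply_const hS hy (by norm_num [one_add_one_eq_two]) _
  have dF : ∀ {y}, y ∈ S → ContDiffWithinAt ℝ 3 f S y → ∀ i, DifferentiableWithinAt ℝ (F i) S y :=
    fun hy h i => (cF hy h i).differentiableWithinAt two_ne_zero
  have dA : ∀ i j, DifferentiableWithinAt ℝ (A i j) S x :=
    fun i j => (cA hx hf i j).differentiableWithinAt one_ne_zero
  have sA : ∀ᶠ y in 𝓝[S] x, ∀ i j, A i j y = A j i y := by
    filter_upwards [e3, eS] with y hy hyS i j
    exact fderivWithin_fderivWithin_comm (hy.of_le (by norm_num)) hS hS' hyS _ _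
  set g : 𝓔 → Matrix ι ι ℝ := fun y => gram ℝ fun i => F i y with hg
  have eG : ∀ᶠ y in 𝓝[S] x, metricCoeff b G y = g y := by
    filter_upwards [hG] with y hy
    ext i j
    simp [metricCoeff, hg, hy, gram_apply, hF]
  have cg : ∀ {y}, y ∈ S → ContDiffWithinAt ℝ 3 f S y → ∀ i j,
      ContDiffWithinAt ℝ 2 (fun y => g y i j) S y :=
    fun hy h i j => (cF hy h i).inner ℝ (cF hy h j)
  -- The first derivatives of the metric coefficients.
  have hdg : ∀ᶠ y in 𝓝[S] x, ∀ k i j, coordDeriv b S k (fun y => metricCoeff b G y i j) y =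
      inner ℝ (A k i y) (F j y) + inner ℝ (F i y) (A k j y) := by
    filter_upwards [e3, eS, eventually_eventually_nhdsWithin.2 eG] with y hy hyS hyG k i j
    have h1 : (fun y => metricCoeff b G y i j) =ᶠ[𝓝[S] y] fun y => inner ℝ (F i y) (F j y) := by
      filter_upwards [hyG] with z hz
      rw [hz]; rfl
    rw [coordDeriv, h1.fderivWithin_eq_of_mem hyS,
      fderivWithin_inner_apply (hS y hyS) (dF hyS hy i) (dF hyS hy j)]
    ring
  have unit : ∀ᶠ y in 𝓝[S] x, IsUnit (g y).det := by
    have hc : ContinuousWithinAt (fun y => (g y).det) S x :=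
      (ContDiffWithinAt.matrix_det (cg hx hf)).continuousWithinAt
    exact (hc.eventually_ne (isUnit_det_gram hd).ne_zero).mono fun y hy => isUnit_iff_ne_zero.2 hy
  -- The Christoffel symbols are the coefficients of the tangential part of the second derivative.
  have hΓ : ∀ᶠ y in 𝓝[S] x, ∀ k i j, christoffel b S G k i j y =
      ∑ l, (g y)⁻¹ k l * inner ℝ (A i j y) (F l y) := by
    filter_upwards [hdg, sA, eG] with y h1 h2 h3 k i j
    rw [christoffel, Finset.mul_sum]
    refine Finset.sum_congr rfl fun l _ => ?_
    rw [h1 i j l, h1 j i l, h1 l i j, h3, h2 j i, h2 l i, h2 l j, real_inner_comm (F j y)]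
    ring
  have dΓ : ∀ k i j, DifferentiableWithinAt ℝ (christoffel b S G k i j) S x := by
    intro k i j
    have : ContDiffWithinAt ℝ 1 (fun y => ∑ l, (g y)⁻¹ k l * inner ℝ (A i j y) (F l y)) S x := by
      refine ContDiffWithinAt.sum fun l _ => ContDiffWithinAt.mul
        (ContDiffWithinAt.matrix_inv (fun i j => (cg hx hf i j).of_le (by norm_num))
          (unit.self_of_nhdsWithin hx) k l)
        ((cA hx hf i j).inner ℝ ((cF hx hf l).of_le (by norm_num)))
    exact (this.differentiableWithinAt one_ne_zero).congr_of_eventuallyEq_of_mem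
      (hΓ.mono fun y hy => hy k i j) hx
  set n : ι → ι → 𝓔 → W := fun i j y => A i j y - ∑ k, christoffel b S G k i j y • F k y with hn
  have hnorm : ∀ᶠ y in 𝓝[S] x, ∀ i j, n i j y = normalPart (fun i => F i y) (A i j y) := by
    filter_upwards [hΓ] with y h i j
    simp only [hn, h, normalPart, hg]
  have hnF : ∀ᶠ y in 𝓝[S] x, ∀ i j p, inner ℝ (n i j y) (F p y) = 0 := by
    filter_upwards [hnorm, unit] with y h hu i j p
    rw [h]
    exact inner_normalPart_left hu _ p
  have dn : ∀ i j, DifferentiableWithinAt ℝ (n i j) S x := fun i j =>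
    (dA i j).sub (DifferentiableWithinAt.fun_sum fun k _ => (dΓ k i j).smul (dF hx hf k))
  have hΓx := hΓ.self_of_nhdsWithin hx
  have hnx := hnorm.self_of_nhdsWithin hx
  have hnFx := hnF.self_of_nhdsWithin hx
  have hux := unit.self_of_nhdsWithin hx
  have tang : ∀ i j p, ∑ m, christoffel b S G m i j x * g x m p = inner ℝ (A i j x) (F p x) := by
    intro i j p
    have := hnFx i j p
    simp only [hn, inner_sub_left, sum_inner, inner_smul_left, RCLike.conj_to_real] at this
    simp only [hg, gram_apply]
    linarith
  -- Differentiating the decomposition of the second derivative, and pairing with a tangent vector.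
  have key : ∀ i j k p, inner ℝ (fderivWithin ℝ (A j k) S x (b i)) (F p x) =
      ∑ l, g x l p * (coordDeriv b S i (christoffel b S G l j k) x
        + ∑ m, christoffel b S G l i m x * christoffel b S G m j k x)
      - inner ℝ (n j k x) (n i p x) := by
    intro i j k p
    have e1 : A j k = fun y => n j k y + ∑ l, christoffel b S G l j k y • F l y := by
      ext y; simp [hn]
    have e2 : fderivWithin ℝ (A j k) S x (b i) = fderivWithin ℝ (n j k) S x (b i)
        + ∑ l, (christoffel b S G l j k x • A i l x
          + coordDeriv b S i (christoffel b S G l j k) x • F l x) := by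
      have hs : ∀ l ∈ Finset.univ, DifferentiableWithinAt ℝ
          (fun y => christoffel b S G l j k y • F l y) S x :=
        fun l _ => (dΓ l j k).smul (dF hx hf l)
      rw [e1, fderivWithin_fun_add (hS x hx) (dn j k) (DifferentiableWithinAt.fun_sum hs),
        fderivWithin_fun_sum (hS x hx) hs]
      simp only [_root_.add_apply, _root_.sum_apply]
      congr 1
      refine Finset.sum_congr rfl fun l _ => ?_
      rw [fderivWithin_fun_smul (hS x hx) (dΓ _ _ _) (dF hx hf l)]
      simp [hA, coordDeriv]
    have e3 : inner ℝ (n j k x) (A i p x)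
        + inner ℝ (fderivWithin ℝ (n j k) S x (b i)) (F p x) = 0 := by
      have := fderivWithin_inner_apply (hS x hx) (dn j k) (dF hx hf p) (b i)
      rw [← this, Filter.EventuallyEq.fderivWithin_eq_of_mem
        (hnF.mono fun y hy => (hy j k p : _ = (fun _ => (0 : ℝ)) y)) hx]
      simp
    have e4 : inner ℝ (n j k x) (A i p x) = inner ℝ (n j k x) (n i p x) := by
      have : A i p x = n i p x + ∑ l, christoffel b S G l i p x • F l x := by simp [hn]
      rw [this, inner_add_right, inner_sum]
      simp [inner_smul_right, hnFx]
    rw [e2, inner_add_left, sum_inner]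
    have e5 : ∑ l, g x l p * ∑ m, christoffel b S G l i m x * christoffel b S G m j k x =
        ∑ m, christoffel b S G m j k x * inner ℝ (A i m x) (F p x) := by
      simp_rw [← tang, Finset.mul_sum]
      rw [Finset.sum_comm]
      exact Finset.sum_congr rfl fun l _ => Finset.sum_congr rfl fun k _ => by ring
    simp only [inner_add_left, inner_smul_left, RCLike.conj_to_real, mul_add,
      Finset.sum_add_distrib, e5]
    have e6 : ∑ l, coordDeriv b S i (christoffel b S G l j k) x * inner ℝ (F l x) (F p x) =
        ∑ l, g x l p * coordDeriv b S i (christoffel b S G l j k) x :=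
      Finset.sum_congr rfl fun l _ => by simp only [hg, gram_apply]; ring
    rw [e6]
    linarith
  have third : ∀ i j k, fderivWithin ℝ (A j k) S x (b i) = fderivWithin ℝ (A i k) S x (b j) :=
    fun i j k => fderivWithin_fderivWithin_comm (cF hx hf k) hS hS' hx _ _
  -- Antisymmetrizing in `i`, `j` cancels the third derivatives and leaves the curvature tensor.
  have lower : ∀ i j k p, ∑ l, g x l p * riemannCoeff b S G l k i j x =
      inner ℝ (n j k x) (n i p x) - inner ℝ (n i k x) (n j p x) := by
    intro i j k p
    have h1 := key i j k p
    have h2 := key j i k p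
    rw [third i j k, h2] at h1
    have h3 : ∑ l, g x l p * riemannCoeff b S G l k i j x =
        ∑ l, g x l p * (coordDeriv b S i (christoffel b S G l j k) x
          + ∑ m, christoffel b S G l i m x * christoffel b S G m j k x)
        - ∑ l, g x l p * (coordDeriv b S j (christoffel b S G l i k) x
          + ∑ m, christoffel b S G l j m x * christoffel b S G m i k x) := by
      rw [← Finset.sum_sub_distrib]
      refine Finset.sum_congr rfl fun l _ => ?_
      rw [riemannCoeff, Finset.sum_sub_distrib]
      ring
    rw [h3]; linarith
  have raise : ∀ i j k q, riemannCoeff b S G q k i j x =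
      ∑ p, (g x)⁻¹ q p * (inner ℝ (n j k x) (n i p x) - inner ℝ (n i k x) (n j p x)) := by
    intro i j k q
    have h1 : ∀ l, ∑ p, (g x)⁻¹ q p * g x l p = if q = l then 1 else 0 := by
      intro l
      have h2 : ((g x)⁻¹ * g x) q l = (1 : Matrix ι ι ℝ) q l := by rw [nonsing_inv_mul _ hux]
      rw [mul_apply, one_apply] at h2
      rw [← h2]
      refine Finset.sum_congr rfl fun p _ => ?_
      simp only [hg, gram_apply, real_inner_comm]
    simp_rw [← lower, Finset.mul_sum]
    rw [Finset.sum_comm]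
    simp_rw [← mul_assoc, ← Finset.sum_mul, h1]
    simp
  have hsnd : ∀ i j, fderivWithin ℝ (fderivWithin ℝ f S) S x (b i) (b j) = A i j x := fun i j =>
    (fderivWithin_fderivWithin_apply (hf.of_le (by norm_num)) hS hx _ _).symm
  simp only [coordScalarCurvature, ricciCoeff, gaussScal, eG.self_of_nhdsWithin hx, raise, hsnd, hnx,
    hg, hF]

end GaussEquation

/-! ### Algebra of the Gauss expression -/

section GaussAlgebra

open Filter Topology Matrix

variable {W : Type*} [NormedAddCommGroup W] [InnerProductSpace ℝ W]
  {W' : Type*} [NormedAddCommGroup W'] [InnerProductSpace ℝ W']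
  {ι : Type*} [Fintype ι] [DecidableEq ι] {ι' : Type*} [Fintype ι'] [DecidableEq ι']

lemma normalPart_smul (d : ι → W) (c : ℝ) (w : W) : normalPart d (c • w) = c • normalPart d w := by
  simp only [normalPart, inner_smul_left, RCLike.conj_to_real, smul_sub, Finset.smul_sum, smul_smul,
    Finset.mul_sum]
  congr 1
  exact Finset.sum_congr rfl fun k _ => by
    congr 1; exact Finset.sum_congr rfl fun l _ => by ring

lemma normalPart_add (d : ι → W) (w w' : W) :
    normalPart d (w + w') = normalPart d w + normalPart d w' := by
  simp only [normalPart, inner_add_left, mul_add, Finset.sum_add_distrib, add_smul]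
  abel

/-- Orthogonal projection to the complement of the span of `d`, as a linear map. -/
def normalPartₗ (d : ι → W) : W →ₗ[ℝ] W where
  toFun := normalPart d
  map_add' := normalPart_add d
  map_smul' := normalPart_smul d

@[simp] lemma normalPartₗ_apply (d : ι → W) (w : W) : normalPartₗ d w = normalPart d w := rfl

lemma normalPart_zero (d : ι → W) : normalPart d 0 = 0 := (normalPartₗ d).map_zero

lemma normalPart_of_mem_span {d : ι → W} (hd : IsUnit (gram ℝ d).det) {y : W}
    (hy : y ∈ Submodule.span ℝ (Set.range d)) : normalPart d y = 0 :=
  normalPart_eq_of hd (by simpa using hy) (by simp)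

lemma normalPart_congr_of_sub_mem {d : ι → W} (hd : IsUnit (gram ℝ d).det) {y z : W}
    (hy : y - z ∈ Submodule.span ℝ (Set.range d)) : normalPart d y = normalPart d z := by
  have := normalPart_of_mem_span hd hy
  rw [← normalPartₗ_apply, map_sub, sub_eq_zero] at this
  exact this

/-- The normal part depends only on the span of the family. -/
lemma normalPart_congr_span {d : ι → W} {d' : ι' → W} (hd : IsUnit (gram ℝ d).det)
    (hd' : IsUnit (gram ℝ d').det)
    (h : Submodule.span ℝ (Set.range d) = Submodule.span ℝ (Set.range d')) (w : W) :
    normalPart d w = normalPart d' w := by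
  refine normalPart_eq_of hd (h ▸ sub_normalPart_mem d' w) fun p => ?_
  exact inner_normalPart_span hd' w (h ▸ Submodule.subset_span ⟨p, rfl⟩)

lemma gaussScal_smul (d : ι → W) (c : ℝ) (s : ι → ι → W) :
    gaussScal d (fun i j => c • s i j) = c ^ 2 * gaussScal d s := by
  simp only [gaussScal, normalPart_smul, inner_smul_left, inner_smul_right, RCLike.conj_to_real,
    Finset.mul_sum]
  exact Finset.sum_congr rfl fun _ _ => Finset.sum_congr rfl fun _ _ =>
    Finset.sum_congr rfl fun _ _ => Finset.sum_congr rfl fun _ _ => by ring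

lemma inner_sum_sum_smul {κ κ' : Type*} [Fintype κ] [Fintype κ'] (c : ι → ι' → ℝ)
    (v : ι → ι' → W) (e : κ → κ' → ℝ) (w : κ → κ' → W) :
    inner ℝ (∑ i, ∑ j, c i j • v i j) (∑ k, ∑ p, e k p • w k p) =
      ∑ i, ∑ j, ∑ k, ∑ p, c i j * e k p * inner ℝ (v i j) (w k p) := by
  rw [sum_inner]
  refine Finset.sum_congr rfl fun i _ => ?_
  rw [sum_inner]
  refine Finset.sum_congr rfl fun j _ => ?_
  rw [inner_sum]
  refine Finset.sum_congr rfl fun k _ => ?_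
  rw [inner_sum]
  refine Finset.sum_congr rfl fun p _ => ?_
  rw [inner_smul_left, inner_smul_right, RCLike.conj_to_real]
  ring

/-- The Gauss expression is invariant under changes of coordinates: the first derivatives change by
an invertible matrix, the second derivatives change tensorially up to tangential terms. -/
theorem gaussScal_change {d : ι → W} {s : ι → ι → W} {d' : ι' → W} {s' : ι' → ι' → W}
    (T : Matrix ι ι' ℝ) (T' : Matrix ι' ι ℝ) (h1 : T * T' = 1) (h2 : T' * T = 1)
    (hd : LinearIndependent ℝ d) (hd' : ∀ a, d' a = ∑ i, T i a • d i)
    (hs' : ∀ a c, s' a c - ∑ i, ∑ j, (T i a * T j c) • s i j ∈ Submodule.span ℝ (Set.range d)) :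
    gaussScal d' s' = gaussScal d s := by
  have hu := isUnit_det_gram hd
  have hg : gram ℝ d' = Tᵀ * gram ℝ d * T := by
    ext a c
    simp only [gram_apply, hd', sum_inner, inner_sum, inner_smul_left, inner_smul_right,
      RCLike.conj_to_real, mul_apply, transpose_apply, Finset.sum_mul, Finset.mul_sum]
    exact Finset.sum_congr rfl fun _ _ => Finset.sum_congr rfl fun _ _ => by ring
  have hd2 : ∀ i, d i = ∑ a, T' a i • d' a := by
    intro i
    simp only [hd', Finset.smul_sum, smul_smul]
    rw [Finset.sum_comm]
    simp_rw [← Finset.sum_smul]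
    have : ∀ j, ∑ a, T' a i * T j a = if j = i then 1 else 0 := by
      intro j
      have h3 : (T * T') j i = (1 : Matrix ι ι ℝ) j i := by rw [h1]
      rw [mul_apply, one_apply] at h3
      rw [← h3]
      exact Finset.sum_congr rfl fun _ _ => mul_comm _ _
    simp [this]
  have hspan : Submodule.span ℝ (Set.range d') = Submodule.span ℝ (Set.range d) := by
    refine le_antisymm (Submodule.span_le.2 ?_) (Submodule.span_le.2 ?_)
    · rintro _ ⟨a, rfl⟩
      rw [hd']
      exact Submodule.sum_mem _ fun i _ => Submodule.smul_mem _ _ (Submodule.subset_span ⟨i, rfl⟩)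
    · rintro _ ⟨i, rfl⟩
      rw [hd2]
      exact Submodule.sum_mem _ fun i _ => Submodule.smul_mem _ _ (Submodule.subset_span ⟨i, rfl⟩)
  have h3 : T'ᵀ * Tᵀ = 1 := by rw [← transpose_mul, h1, transpose_one]
  have hleft : T' * (gram ℝ d)⁻¹ * T'ᵀ * gram ℝ d' = 1 := by
    rw [hg]
    calc T' * (gram ℝ d)⁻¹ * T'ᵀ * (Tᵀ * gram ℝ d * T)
        = T' * ((gram ℝ d)⁻¹ * ((T'ᵀ * Tᵀ) * gram ℝ d)) * T := by simp only [Matrix.mul_assoc]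
      _ = 1 := by rw [h3, Matrix.one_mul, nonsing_inv_mul _ hu, Matrix.mul_one, h2]
  have hinv : (gram ℝ d')⁻¹ = T' * (gram ℝ d)⁻¹ * T'ᵀ := inv_eq_left_inv hleft
  have hu' : IsUnit (gram ℝ d').det :=
    (isUnit_iff_isUnit_det _).1 (IsUnit.of_mul_eq_one_right _ hleft)
  -- Contraction with the inverse Gram matrix does not depend on the coordinates.
  have hcontr : ∀ φ : ι → ι → ℝ, ∑ a, ∑ c, (gram ℝ d')⁻¹ a c * ∑ j, ∑ k, T j a * T k c * φ j k =
      ∑ j, ∑ k, (gram ℝ d)⁻¹ j k * φ j k := by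
    intro φ
    have h6 : ∀ j k, ∑ a, ∑ c, T j a * (gram ℝ d')⁻¹ a c * T k c = (gram ℝ d)⁻¹ j k := by
      intro j k
      have h4 : T * (gram ℝ d')⁻¹ * Tᵀ = (gram ℝ d)⁻¹ := by
        rw [hinv]
        calc T * (T' * (gram ℝ d)⁻¹ * T'ᵀ) * Tᵀ = (T * T') * (gram ℝ d)⁻¹ * (T'ᵀ * Tᵀ) := by
              simp only [Matrix.mul_assoc]
          _ = _ := by rw [h1, h3, Matrix.one_mul, Matrix.mul_one]
      rw [← h4]
      simp only [mul_apply, transpose_apply, Finset.sum_mul]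
      rw [Finset.sum_comm]
    simp_rw [← h6, Finset.mul_sum, Finset.sum_mul]
    calc _ = ∑ a, ∑ j, ∑ c, ∑ k, (gram ℝ d')⁻¹ a c * (T j a * T k c * φ j k) :=
          Finset.sum_congr rfl fun _ _ => Finset.sum_comm
      _ = ∑ j, ∑ a, ∑ c, ∑ k, (gram ℝ d')⁻¹ a c * (T j a * T k c * φ j k) := Finset.sum_comm
      _ = ∑ j, ∑ a, ∑ k, ∑ c, (gram ℝ d')⁻¹ a c * (T j a * T k c * φ j k) :=
          Finset.sum_congr rfl fun _ _ => Finset.sum_congr rfl fun _ _ => Finset.sum_comm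
      _ = ∑ j, ∑ k, ∑ a, ∑ c, (gram ℝ d')⁻¹ a c * (T j a * T k c * φ j k) :=
          Finset.sum_congr rfl fun _ _ => Finset.sum_comm
      _ = _ := Finset.sum_congr rfl fun _ _ => Finset.sum_congr rfl fun _ _ =>
          Finset.sum_congr rfl fun _ _ => Finset.sum_congr rfl fun _ _ => by ring
  have hn : ∀ a c, normalPart d' (s' a c) =
      ∑ i, ∑ j, (T i a * T j c) • normalPart d (s i j) := by
    intro a c
    rw [normalPart_congr_span hu' hu hspan, normalPart_congr_of_sub_mem hu (hs' a c)]
    simp only [← normalPartₗ_apply, map_sum, map_smul]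
  have hR : ∀ a c e f, inner ℝ (normalPart d' (s' a c)) (normalPart d' (s' e f))
        - inner ℝ (normalPart d' (s' e c)) (normalPart d' (s' a f)) =
      ∑ j, ∑ k, T j a * T k c * ∑ i, ∑ p, T i e * T p f *
        (inner ℝ (normalPart d (s j k)) (normalPart d (s i p))
          - inner ℝ (normalPart d (s i k)) (normalPart d (s j p))) := by
    intro a c e f
    simp only [hn, inner_sum_sum_smul, mul_sub, Finset.sum_sub_distrib, Finset.mul_sum]
    congr 1
    · exact Finset.sum_congr rfl fun _ _ => Finset.sum_congr rfl fun _ _ =>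
        Finset.sum_congr rfl fun _ _ => Finset.sum_congr rfl fun _ _ => by ring
    · calc _ = ∑ j, ∑ i, ∑ k, ∑ p, _ :=
            (Finset.sum_congr rfl fun _ _ => Finset.sum_comm).trans Finset.sum_comm
        _ = ∑ j, ∑ k, ∑ i, ∑ p, _ := Finset.sum_congr rfl fun _ _ => Finset.sum_comm
        _ = _ := Finset.sum_congr rfl fun _ _ => Finset.sum_congr rfl fun _ _ =>
          Finset.sum_congr rfl fun _ _ => Finset.sum_congr rfl fun _ _ => by ring
  simp only [gaussScal, hR]
  rw [← hcontr]
  refine Finset.sum_congr rfl fun a _ => Finset.sum_congr rfl fun c _ => ?_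
  congr 1
  have : ∀ e f, ∑ j, ∑ k, T j a * T k c * ∑ i, ∑ p, T i e * T p f *
        (inner ℝ (normalPart d (s j k)) (normalPart d (s i p))
          - inner ℝ (normalPart d (s i k)) (normalPart d (s j p))) =
      ∑ i, ∑ p, T i e * T p f * ∑ j, ∑ k, T j a * T k c *
        (inner ℝ (normalPart d (s j k)) (normalPart d (s i p))
          - inner ℝ (normalPart d (s i k)) (normalPart d (s j p))) := by
    intro e f
    simp only [Finset.mul_sum]
    calc _ = ∑ j, ∑ i, ∑ k, ∑ p, _ := Finset.sum_congr rfl fun _ _ => Finset.sum_comm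
      _ = ∑ i, ∑ j, ∑ k, ∑ p, _ := Finset.sum_comm
      _ = ∑ i, ∑ j, ∑ p, ∑ k, _ :=
          Finset.sum_congr rfl fun _ _ => Finset.sum_congr rfl fun _ _ => Finset.sum_comm
      _ = ∑ i, ∑ p, ∑ j, ∑ k, _ := Finset.sum_congr rfl fun _ _ => Finset.sum_comm
      _ = _ := Finset.sum_congr rfl fun _ _ => Finset.sum_congr rfl fun _ _ =>
          Finset.sum_congr rfl fun _ _ => Finset.sum_congr rfl fun _ _ => by ring
  simp_rw [this]
  rw [hcontr]
  simp only [Finset.mul_sum]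
  calc _ = ∑ i, ∑ j, ∑ p, ∑ k, _ := Finset.sum_congr rfl fun _ _ => Finset.sum_comm
    _ = ∑ j, ∑ i, ∑ p, ∑ k, _ := Finset.sum_comm
    _ = ∑ j, ∑ i, ∑ k, ∑ p, _ :=
        Finset.sum_congr rfl fun _ _ => Finset.sum_congr rfl fun _ _ => Finset.sum_comm
    _ = ∑ j, ∑ k, ∑ i, ∑ p, _ := Finset.sum_congr rfl fun _ _ => Finset.sum_comm
    _ = _ := Finset.sum_congr rfl fun _ _ => Finset.sum_congr rfl fun _ _ =>
        Finset.sum_congr rfl fun _ _ => Finset.sum_congr rfl fun _ _ => by ring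

variable {𝓔 : Type*} [NormedAddCommGroup 𝓔] [NormedSpace ℝ 𝓔]
  {𝓔' : Type*} [NormedAddCommGroup 𝓔'] [NormedSpace ℝ 𝓔']

/-- The Gauss expression of a first derivative `D` and a second derivative `s`. -/
def jetScal (b : Module.Basis ι ℝ 𝓔) (D : 𝓔 →L[ℝ] W) (s : 𝓔 →L[ℝ] 𝓔 →L[ℝ] W) : ℝ :=
  gaussScal (fun i => D (b i)) fun i j => s (b i) (b j)

lemma linearIndependent_of_injective (b : Module.Basis ι ℝ 𝓔) {D : 𝓔 →L[ℝ] W}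
    (hD : Function.Injective D) : LinearIndependent ℝ fun i => D (b i) :=
  b.linearIndependent.map' D.toLinearMap (LinearMap.ker_eq_bot.2 hD)

lemma injective_of_linearIndependent (b : Module.Basis ι ℝ 𝓔) {D : 𝓔 →L[ℝ] W}
    (hD : LinearIndependent ℝ fun i => D (b i)) : Function.Injective D := by
  have h : LinearMap.ker D.toLinearMap = ⊥ := by
    refine LinearMap.ker_eq_bot'.2 fun v hv => ?_
    have h0 : ∑ i, b.repr v i • D (b i) = 0 := by
      rw [← b.sum_repr v] at hv
      simpa only [map_sum, map_smul, ContinuousLinearMap.coe_coe] using hv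
    have := Fintype.linearIndependent_iff.1 hD _ h0
    rw [← b.sum_repr v]
    simp [this]
  exact LinearMap.ker_eq_bot.1 h

lemma span_range_basis (b : Module.Basis ι ℝ 𝓔) (D : 𝓔 →L[ℝ] W) :
    Submodule.span ℝ (Set.range fun i => D (b i)) = LinearMap.range D.toLinearMap := by
  have : (Set.range fun i => D (b i)) = D.toLinearMap '' Set.range b := by
    rw [← Set.range_comp]; rfl
  rw [this, Submodule.span_image, b.span_eq, Submodule.map_top]

/-- Invariance of the Gauss expression under a linear change `θ` of the coordinates, up to
tangential terms in the second derivative. -/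
theorem gaussScal_comp (b : Module.Basis ι ℝ 𝓔) (b' : Module.Basis ι' ℝ 𝓔') (θ : 𝓔' ≃ₗ[ℝ] 𝓔)
    {D : 𝓔 →L[ℝ] W} (hD : Function.Injective D) {s : 𝓔 →L[ℝ] 𝓔 →L[ℝ] W}
    {d' : ι' → W} {s' : ι' → ι' → W} (hd' : ∀ a, d' a = D (θ (b' a)))
    (hs' : ∀ a c, s' a c - s (θ (b' a)) (θ (b' c)) ∈ LinearMap.range D.toLinearMap) :
    gaussScal d' s' = jetScal b D s := by
  have hθ : ∀ a, θ (b' a) = ∑ i, LinearMap.toMatrix b' b θ.toLinearMap i a • b i := by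
    intro a
    simp only [LinearMap.toMatrix_apply]
    exact (b.sum_repr _).symm
  refine gaussScal_change (LinearMap.toMatrix b' b θ.toLinearMap)
    (LinearMap.toMatrix b b' θ.symm.toLinearMap) ?_ ?_ (linearIndependent_of_injective b hD) ?_ ?_
  · rw [← LinearMap.toMatrix_comp, LinearEquiv.comp_symm, LinearMap.toMatrix_id]
  · rw [← LinearMap.toMatrix_comp, LinearEquiv.symm_comp, LinearMap.toMatrix_id]
  · intro a
    rw [hd', hθ]
    simp only [map_sum, map_smul]
  · intro a c
    rw [span_range_basis]
    convert hs' a c using 2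
    rw [hθ a, hθ c]
    simp only [map_sum, map_smul, _root_.sum_apply, _root_.smul_apply, Finset.smul_sum, smul_smul]
    rw [Finset.sum_comm]
    exact Finset.sum_congr rfl fun _ _ => Finset.sum_congr rfl fun _ _ => by rw [mul_comm]

/-- The form of `gaussScal_comp` for derivatives given as (bi)linear maps on both sides. -/
theorem jetScal_comp (b : Module.Basis ι ℝ 𝓔) (b' : Module.Basis ι' ℝ 𝓔') (θ : 𝓔' ≃ₗ[ℝ] 𝓔)
    {D : 𝓔 →L[ℝ] W} (hD : Function.Injective D) {s : 𝓔 →L[ℝ] 𝓔 →L[ℝ] W}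
    {D' : 𝓔' →L[ℝ] W} {s' : 𝓔' →L[ℝ] 𝓔' →L[ℝ] W} (hD' : ∀ v, D' v = D (θ v))
    (hs' : ∀ v w, s' v w - s (θ v) (θ w) ∈ LinearMap.range D.toLinearMap) :
    jetScal b' D' s' = jetScal b D s :=
  gaussScal_comp b b' θ hD (fun _ => hD' _) fun _ _ => hs' _ _

/-- The Gauss expression depends continuously on the derivatives, where the first derivatives are
linearly independent. -/
lemma continuousAt_gaussScal {d : ι → W} (hd : LinearIndependent ℝ d) (s : ι → ι → W) :
    ContinuousAt (fun q : (ι → W) × (ι → ι → W) => gaussScal q.1 q.2) (d, s) := by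
  have hdi : ∀ i, ContDiffWithinAt ℝ 0 (fun q : (ι → W) × (ι → ι → W) => q.1 i) Set.univ (d, s) :=
    fun i => (by fun_prop : ContDiff ℝ 0 fun q : (ι → W) × (ι → ι → W) => q.1 i).contDiffWithinAt
  have hsi : ∀ i j, ContDiffWithinAt ℝ 0 (fun q : (ι → W) × (ι → ι → W) => q.2 i j) Set.univ
      (d, s) := fun i j =>
    (by fun_prop : ContDiff ℝ 0 fun q : (ι → W) × (ι → ι → W) => q.2 i j).contDiffWithinAt
  have hinv : ∀ i j, ContDiffWithinAt ℝ 0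
      (fun q : (ι → W) × (ι → ι → W) => (gram ℝ q.1)⁻¹ i j) Set.univ (d, s) := fun i j =>
    ContDiffWithinAt.matrix_inv (A := fun q : (ι → W) × (ι → ι → W) => gram ℝ q.1)
      (fun i j => (hdi i).inner ℝ (hdi j)) (isUnit_det_gram hd) i j
  have hn : ∀ i j, ContDiffWithinAt ℝ 0
      (fun q : (ι → W) × (ι → ι → W) => normalPart q.1 (q.2 i j)) Set.univ (d, s) := fun i j =>
    (hsi i j).sub (ContDiffWithinAt.sum fun k _ => (ContDiffWithinAt.sum fun l _ =>
      (hinv k l).mul ((hsi i j).inner ℝ (hdi l))).smul (hdi k))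
  have : ContDiffWithinAt ℝ 0 (fun q : (ι → W) × (ι → ι → W) => gaussScal q.1 q.2) Set.univ
      (d, s) :=
    ContDiffWithinAt.sum fun j _ => ContDiffWithinAt.sum fun k _ => (hinv j k).mul
      (ContDiffWithinAt.sum fun i _ => ContDiffWithinAt.sum fun p _ => (hinv i p).mul
        (((hn j k).inner ℝ (hn i p)).sub ((hn i k).inner ℝ (hn j p))))
  exact (contDiffWithinAt_univ.1 this).continuousAt

lemma Filter.Tendsto.clm_apply' {α V V' : Type*} [NormedAddCommGroup V] [NormedSpace ℝ V]
    [NormedAddCommGroup V'] [NormedSpace ℝ V'] {l : Filter α} {D : α → V →L[ℝ] V'}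
    {D₀ : V →L[ℝ] V'} {v : α → V} {v₀ : V} (hD : Tendsto D l (𝓝 D₀)) (hv : Tendsto v l (𝓝 v₀)) :
    Tendsto (fun a => D a (v a)) l (𝓝 (D₀ v₀)) := by
  have h : Continuous fun q : (V →L[ℝ] V') × V => q.1 q.2 := isBoundedBilinearMap_apply.continuous
  exact (h.tendsto (D₀, v₀)).comp (hD.prodMk_nhds hv)

lemma tendsto_gaussScal {α : Type*} {l : Filter α} {d : α → ι → W} {s : α → ι → ι → W}
    {d₀ : ι → W} {s₀ : ι → ι → W} (hd₀ : LinearIndependent ℝ d₀)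
    (hd : ∀ i, Tendsto (fun a => d a i) l (𝓝 (d₀ i)))
    (hs : ∀ i j, Tendsto (fun a => s a i j) l (𝓝 (s₀ i j))) :
    Tendsto (fun a => gaussScal (d a) (s a)) l (𝓝 (gaussScal d₀ s₀)) := by
  have h1 : Tendsto d l (𝓝 d₀) := tendsto_pi_nhds.2 hd
  have h2 : Tendsto s l (𝓝 s₀) := tendsto_pi_nhds.2 fun i => tendsto_pi_nhds.2 fun j => hs i j
  exact Filter.Tendsto.comp (f := fun a => (d a, s a))
    (g := fun q : (ι → W) × (ι → ι → W) => gaussScal q.1 q.2) (continuousAt_gaussScal hd₀ s₀)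
    (h1.prodMk_nhds h2)

lemma eventually_linearIndependent {α : Type*} {l : Filter α} {d : α → ι → W} {d₀ : ι → W}
    (hd₀ : LinearIndependent ℝ d₀) (hd : ∀ i, Tendsto (fun a => d a i) l (𝓝 (d₀ i))) :
    ∀ᶠ a in l, LinearIndependent ℝ (d a) := by
  have h1 : Tendsto d l (𝓝 d₀) := tendsto_pi_nhds.2 hd
  have h2 : Continuous fun d : ι → W => (gram ℝ d).det := by
    refine Continuous.matrix_det ?_
    exact continuous_matrix fun i j => by simp only [gram_apply]; fun_prop
  filter_upwards [((h2.tendsto _).comp h1).eventually_ne (isUnit_det_gram hd₀).ne_zero] with a ha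
  exact det_gram_ne_zero_iff_linearIndependent.1 ha

end GaussAlgebra

/-! ### Cylinders -/

section Cylinder

open Filter Topology Matrix

variable {W : Type*} [NormedAddCommGroup W] [InnerProductSpace ℝ W]
  {Z : Type*} [NormedAddCommGroup Z] [InnerProductSpace ℝ Z]
  {ι : Type*} [Fintype ι] [DecidableEq ι] {ι' : Type*} [Fintype ι'] [DecidableEq ι']

/-- The Gauss expression of an orthogonal sum of a linear piece `d₁`, without second derivatives,
and the image of `(e, u)` under a linear isometry `J`. -/
lemma gaussScal_orthogonal_sum {d₁ : ι → W} {e : ι' → Z} {u : ι' → ι' → Z} (J : Z →ₗ[ℝ] W)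
    (hJ : ∀ z z', inner ℝ (J z) (J z') = inner ℝ z z') (horth : ∀ i z, inner ℝ (d₁ i) (J z) = 0)
    (hd₁ : LinearIndependent ℝ d₁) (he : LinearIndependent ℝ e)
    {d : ι ⊕ ι' → W} {s : ι ⊕ ι' → ι ⊕ ι' → W} (hdl : ∀ i, d (.inl i) = d₁ i)
    (hdr : ∀ a, d (.inr a) = J (e a)) (hsl : ∀ i q, s (.inl i) q = 0)
    (hsl' : ∀ q i, s q (.inl i) = 0) (hsr : ∀ a c, s (.inr a) (.inr c) = J (u a c)) :
    gaussScal d s = gaussScal e u := by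
  have hg : gram ℝ d = fromBlocks (gram ℝ d₁) 0 0 (gram ℝ e) := by
    ext (i | a) (j | c)
    · simp [gram_apply, hdl]
    · simp [gram_apply, hdl, hdr, horth]
    · rw [gram_apply, hdl, hdr, real_inner_comm, horth]; rfl
    · simp [gram_apply, hdr, hJ]
  have hu₁ := isUnit_det_gram hd₁
  have hu₂ := isUnit_det_gram he
  have hinv : (gram ℝ d)⁻¹ = fromBlocks (gram ℝ d₁)⁻¹ 0 0 (gram ℝ e)⁻¹ := by
    rw [hg]
    refine inv_eq_left_inv ?_
    rw [fromBlocks_multiply]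
    simp [nonsing_inv_mul _ hu₁, nonsing_inv_mul _ hu₂]
  have hu : IsUnit (gram ℝ d).det := by
    rw [hg, det_fromBlocks_zero₂₁]
    exact hu₁.mul hu₂
  have hn : ∀ z, normalPart d (J z) = J (normalPart e z) := by
    intro z
    refine normalPart_eq_of hu ?_ ?_
    · rw [← map_sub]
      have h1 := Submodule.mem_map_of_mem (f := J) (sub_normalPart_mem e z)
      rw [Submodule.map_span, ← Set.range_comp] at h1
      refine Submodule.span_mono ?_ h1
      rintro _ ⟨a, rfl⟩
      exact ⟨.inr a, hdr a⟩
    · rintro (i | a)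
      · rw [hdl, real_inner_comm, horth]
      · rw [hdr, hJ, inner_normalPart_left hu₂]
  have h11 : ∀ i j, (gram ℝ d)⁻¹ (.inl i) (.inr j) = 0 := by intro i j; rw [hinv]; rfl
  have h22 : ∀ i j, (gram ℝ d)⁻¹ (.inr i) (.inr j) = (gram ℝ e)⁻¹ i j := by
    intro i j; rw [hinv]; rfl
  simp only [gaussScal, Fintype.sum_sum_type, hsl, hsl', hsr, hn, hJ, h11, h22, normalPart_zero,
    inner_zero_left, inner_zero_right, sub_zero, mul_zero, Finset.sum_const_zero, zero_add]

variable {𝓐 : Type*} [NormedAddCommGroup 𝓐] [NormedSpace ℝ 𝓐]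
  {𝓨 : Type*} [NormedAddCommGroup 𝓨] [NormedSpace ℝ 𝓨]

/-- The map `(a, y) ↦ L a + M (φ y)` with `L` and `M` linear parametrizes a cylinder over the
projection of `M ∘ φ` to the orthogonal complement of `L`. If this projection is isometric on the
image of `M`, then the cylinder has the scalar curvature of `φ`. -/
theorem jetScal_cylinder (bA : Module.Basis ι ℝ 𝓐) (bY : Module.Basis ι' ℝ 𝓨) {L : 𝓐 →L[ℝ] W}
    (hL : Function.Injective L) {M : Z →L[ℝ] W}
    (hM : ∀ z z', inner ℝ (normalPart (fun i => L (bA i)) (M z))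
      (normalPart (fun i => L (bA i)) (M z')) = inner ℝ z z')
    {φ₁ : 𝓨 →L[ℝ] Z} (hφ₁ : Function.Injective φ₁) {φ₂ : 𝓨 →L[ℝ] 𝓨 →L[ℝ] Z}
    {D : 𝓐 × 𝓨 →L[ℝ] W} (hD : ∀ a y, D (a, y) = L a + M (φ₁ y))
    {s : 𝓐 × 𝓨 →L[ℝ] 𝓐 × 𝓨 →L[ℝ] W} (hs : ∀ a y a' y', s (a, y) (a', y') = M (φ₂ y y')) :
    Function.Injective D ∧ jetScal (bA.prod bY) D s = jetScal bY φ₁ φ₂ := by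
  set d₁ : ι → W := fun i => L (bA i) with hd₁
  have hu₁ := isUnit_det_gram (linearIndependent_of_injective bA hL)
  have hspan := span_range_basis bA L
  have hDinj : Function.Injective D := by
    refine (injective_iff_map_eq_zero D).2 ?_
    rintro ⟨a, y⟩ h
    rw [hD] at h
    have h1 : normalPart d₁ (M (φ₁ y)) = 0 := by
      have h2 : normalPart d₁ (L a) = 0 :=
        normalPart_of_mem_span hu₁ (by rw [hspan]; exact ⟨a, rfl⟩)
      have h3 := congrArg (normalPart d₁) h
      rwa [normalPart_add, h2, zero_add, normalPart_zero] at h3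
    have h2 : φ₁ y = 0 := by
      have := hM (φ₁ y) (φ₁ y)
      rw [h1, inner_zero_left] at this
      exact inner_self_eq_zero.1 this.symm
    rw [h2, map_zero, add_zero] at h
    rw [(injective_iff_map_eq_zero L).1 hL a h, (injective_iff_map_eq_zero φ₁).1 hφ₁ y h2]
    rfl
  refine ⟨hDinj, ?_⟩
  -- The shear `θ` of the coordinates replaces `M ∘ φ₁` by its component orthogonal to `L`.
  have hc : ∀ j, ∃ a, L a = normalPart d₁ (M (φ₁ (bY j))) - M (φ₁ (bY j)) := by
    intro j
    have := Submodule.neg_mem _ (sub_normalPart_mem d₁ (M (φ₁ (bY j))))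
    rw [hspan, neg_sub] at this
    exact this
  choose c hc using hc
  let τ : 𝓨 →ₗ[ℝ] 𝓐 := bY.constr ℝ c
  have hτ : ∀ j, τ (bY j) = c j := fun j => bY.constr_basis ℝ c j
  let θ : (𝓐 × 𝓨) ≃ₗ[ℝ] (𝓐 × 𝓨) :=
    { toFun := fun p => (p.1 + τ p.2, p.2)
      map_add' := fun p q => by ext <;> simp [add_add_add_comm]
      map_smul' := fun r p => by ext <;> simp
      invFun := fun p => (p.1 - τ p.2, p.2)
      left_inv := fun p => by simp
      right_inv := fun p => by simp }
  have hθ : ∀ p, θ p = (p.1 + τ p.2, p.2) := fun p => rfl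
  set J : Z →ₗ[ℝ] W := (normalPartₗ d₁).comp M.toLinearMap with hJ
  let s' : ι ⊕ ι' → ι ⊕ ι' → W := fun p q => match p, q with
    | .inr a, .inr c => J (φ₂ (bY a) (bY c))
    | _, _ => 0
  rw [← gaussScal_comp (bA.prod bY) (bA.prod bY) θ hDinj
    (d' := Sum.elim d₁ fun a => J (φ₁ (bY a))) (s' := s') ?_ ?_]
  · refine gaussScal_orthogonal_sum J hM (fun i z => ?_) (linearIndependent_of_injective bA hL)
      (linearIndependent_of_injective bY hφ₁) (fun _ => rfl) (fun _ => rfl) (fun i q => ?_)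
      (fun q i => ?_) (fun _ _ => rfl)
    · rw [real_inner_comm]
      exact inner_normalPart_left hu₁ _ _
    · cases q <;> rfl
    · cases q <;> rfl
  · rintro (i | a)
    · rw [hθ, hD]; simp [hd₁]
    · rw [hθ, hD]; simp [hτ, hc, hJ]
  · have hr : ∀ z, J z - M z ∈ LinearMap.range D.toLinearMap := by
      intro z
      have := Submodule.neg_mem _ (sub_normalPart_mem d₁ (M z))
      rw [hspan, neg_sub] at this
      obtain ⟨a, ha⟩ := this
      refine ⟨(a, 0), ?_⟩
      have h1 : D (a, 0) = L a := by rw [hD]; simp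
      exact h1.trans ha
    rintro (i | a) (j | c)
    · rw [hθ, hθ, hs]; simp [s']
    · rw [hθ, hθ, hs]; simp [s']
    · rw [hθ, hθ, hs]; simp [s']
    · rw [hθ, hθ, hs]
      simpa [s'] using hr (φ₂ (bY a) (bY c))

end Cylinder

/-! ### Normalizing an injective linear map by a positive operator -/

section Normalizer

open Filter Topology

variable {W : Type*} [NormedAddCommGroup W] [InnerProductSpace ℝ W] [FiniteDimensional ℝ W]
  {Z : Type*} [NormedAddCommGroup Z] [InnerProductSpace ℝ Z] [FiniteDimensional ℝ Z]

/-- A symmetric and positive definite operator. -/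
structure IsPosDefOp (P : Z →L[ℝ] Z) : Prop where
  symm : P.toLinearMap.IsSymmetric
  pos : ∀ v, v ≠ 0 → 0 < inner ℝ (P v) v

/-- `S` is a positive definite operator such that `N ∘ S` is isometric, that is,
`S = (NᵀN)^{-1/2}`. -/
structure IsNormalizer (N : Z →L[ℝ] W) (S : Z →L[ℝ] Z) : Prop extends IsPosDefOp S where
  isometry : ∀ v w, inner ℝ (N (S v)) (N (S w)) = inner ℝ v w

/-- The Sylvester equation with positive definite coefficients has only the trivial solution. -/
lemma IsPosDefOp.eq_zero_of_sylvester {P P' H : Z →L[ℝ] Z} (hP : IsPosDefOp P)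
    (hP' : IsPosDefOp P') (h : P * H + H * P' = 0) : H = 0 := by
  set e := hP'.symm.eigenvectorBasis rfl with he
  have key : ∀ i, H (e i) = 0 := by
    intro i
    by_contra hne
    set μ := hP'.symm.eigenvalues rfl i with hμ
    have h1 : P' (e i) = μ • e i := hP'.symm.apply_eigenvectorBasis rfl i
    have hei : inner ℝ (e i) (e i) = (1 : ℝ) := by
      rw [real_inner_self_eq_norm_sq, e.norm_eq_one, one_pow]
    have h2 : 0 < μ := by
      have h3 := hP'.pos (e i) (by simpa using e.toBasis.ne_zero i)
      rwa [h1, inner_smul_left, hei, mul_one] at h3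
    have h3 : P (H (e i)) + μ • H (e i) = 0 := by
      have := congrArg (fun T : Z →L[ℝ] Z => T (e i)) h
      simpa [h1] using this
    have h4 : inner ℝ (P (H (e i))) (H (e i)) + μ * inner ℝ (H (e i)) (H (e i)) = (0 : ℝ) := by
      have := congrArg (fun z => inner ℝ z (H (e i))) h3
      simpa [inner_add_left, inner_smul_left] using this
    have h5 := hP.pos _ hne
    have h6 : (0 : ℝ) ≤ inner ℝ (H (e i)) (H (e i)) := real_inner_self_nonneg
    nlinarith [mul_nonneg h2.le h6]
  refine ContinuousLinearMap.coe_injective (e.toBasis.ext fun i => ?_)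
  simpa using key i

lemma IsNormalizer.mul_eq_one {N : Z →L[ℝ] W} {S : Z →L[ℝ] Z} (h : IsNormalizer N S) :
    S * (ContinuousLinearMap.adjoint N ∘L N) * S = 1 := by
  ext v
  refine ext_inner_right ℝ fun w => ?_
  have h1 := h.symm ((ContinuousLinearMap.adjoint N) (N (S v))) w
  simp only [ContinuousLinearMap.coe_coe] at h1
  simp only [mul_apply_eq_comp, ContinuousLinearMap.comp_apply,
    one_apply_eq_self]
  rw [h1, ContinuousLinearMap.adjoint_inner_left, h.isometry]

lemma isNormalizer_of_mul_eq_one {N : Z →L[ℝ] W} {S : Z →L[ℝ] Z} (h : IsPosDefOp S)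
    (h' : S * (ContinuousLinearMap.adjoint N ∘L N) * S = 1) : IsNormalizer N S := by
  refine ⟨h, fun v w => ?_⟩
  have h1 := h.symm ((ContinuousLinearMap.adjoint N) (N (S v))) w
  simp only [ContinuousLinearMap.coe_coe] at h1
  rw [← ContinuousLinearMap.adjoint_inner_left, ← h1]
  have := congrArg (fun T : Z →L[ℝ] Z => T v) h'
  simp only [mul_apply_eq_comp, ContinuousLinearMap.comp_apply,
    one_apply_eq_self] at this
  rw [this]

lemma clm_mul_eq_one_comm {A B : Z →L[ℝ] Z} (h : A * B = 1) : B * A = 1 := by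
  have h1 : A.toLinearMap * B.toLinearMap = 1 := by
    ext v; exact congrArg (fun T : Z →L[ℝ] Z => T v) h
  have h2 := mul_eq_one_comm.1 h1
  ext v; exact congrArg (fun T : Z →ₗ[ℝ] Z => T v) h2

lemma IsNormalizer.unique {N : Z →L[ℝ] W} {S S' : Z →L[ℝ] Z} (h : IsNormalizer N S)
    (h' : IsNormalizer N S') : S = S' := by
  set Q := ContinuousLinearMap.adjoint N ∘L N
  have h1 : Q * (S * S) = 1 := by
    have := clm_mul_eq_one_comm ((mul_assoc _ _ _).symm.trans h.mul_eq_one)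
    rwa [mul_assoc] at this
  have h2 : S' * S' * Q = 1 := by
    have := clm_mul_eq_one_comm h'.mul_eq_one
    rwa [← mul_assoc] at this
  have h3 : S' * S' = S * S := by
    calc S' * S' = S' * S' * (Q * (S * S)) := by rw [h1, mul_one]
      _ = (S' * S' * Q) * (S * S) := by simp only [mul_assoc]
      _ = S * S := by rw [h2, one_mul]
  have h4 : S * (S - S') + (S - S') * S' = 0 := by
    rw [mul_sub, sub_mul, h3]; abel
  exact sub_eq_zero.1 (h.toIsPosDefOp.eq_zero_of_sylvester h'.toIsPosDefOp h4)

lemma exists_isNormalizer {N : Z →L[ℝ] W} (hN : Function.Injective N) : ∃ S, IsNormalizer N S := by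
  set Q := ContinuousLinearMap.adjoint N ∘L N with hQ
  have hQi : ∀ v w, inner ℝ (Q v) w = inner ℝ (N v) (N w) := fun v w => by
    simp [hQ, ContinuousLinearMap.adjoint_inner_left]
  have hsymm : Q.toLinearMap.IsSymmetric := fun v w => by
    simp only [ContinuousLinearMap.coe_coe]
    rw [hQi, real_inner_comm (Q w), hQi, real_inner_comm]
  set e := hsymm.eigenvectorBasis rfl with he
  set μ := hsymm.eigenvalues rfl with hμ
  have hQe : ∀ i, Q (e i) = μ i • e i := fun i => hsymm.apply_eigenvectorBasis rfl i
  have hei : ∀ i j, inner ℝ (e i) (e j) = if i = j then (1 : ℝ) else 0 :=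
    orthonormal_iff_ite.1 e.orthonormal
  have hμpos : ∀ i, 0 < μ i := by
    intro i
    have h1 : μ i = inner ℝ (N (e i)) (N (e i)) := by
      rw [← hQi, hQe, inner_smul_left, hei]; simp
    rw [h1]
    refine real_inner_self_pos.2 fun h => ?_
    have h0 : e i = 0 := hN (by rw [h, map_zero])
    exact e.toBasis.ne_zero i (by simpa using h0)
  let S : Z →L[ℝ] Z := ∑ i, (Real.sqrt (μ i))⁻¹ • (innerSL ℝ (e i)).smulRight (e i)
  have hS : ∀ v, S v = ∑ i, ((Real.sqrt (μ i))⁻¹ * inner ℝ (e i) v) • e i := by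
    intro v
    simp [S, smul_smul]
  have hSi : ∀ v w, inner ℝ (S v) w =
      ∑ i, (Real.sqrt (μ i))⁻¹ * inner ℝ (e i) v * inner ℝ (e i) w := by
    intro v w
    rw [hS, sum_inner]
    exact Finset.sum_congr rfl fun i _ => by rw [inner_smul_left]; rfl
  refine ⟨S, ⟨⟨fun v w => ?_, fun v hv => ?_⟩, fun v w => ?_⟩⟩
  · simp only [ContinuousLinearMap.coe_coe]
    rw [hSi, real_inner_comm, hSi]
    exact Finset.sum_congr rfl fun i _ => by ring
  · rw [hSi]
    have h1 : ∃ i, inner ℝ (e i) v ≠ (0 : ℝ) := by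
      by_contra! h
      exact hv (by rw [← e.sum_repr' v]; simp [h])
    obtain ⟨i, hi⟩ := h1
    refine Finset.sum_pos' (fun j _ => ?_) ⟨i, Finset.mem_univ _, ?_⟩
    · rw [mul_assoc]
      exact mul_nonneg (inv_nonneg.2 (Real.sqrt_nonneg _)) (mul_self_nonneg _)
    · rw [mul_assoc]
      exact mul_pos (inv_pos.2 (Real.sqrt_pos.2 (hμpos i))) (mul_self_pos.2 hi)
  · rw [← hQi]
    have h1 : Q (S v) = ∑ i, (Real.sqrt (μ i) * inner ℝ (e i) v) • e i := by
      rw [hS, map_sum]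
      refine Finset.sum_congr rfl fun i _ => ?_
      rw [map_smul, hQe, smul_smul]
      congr 1
      have h2 := Real.mul_self_sqrt (hμpos i).le
      have h3 := (Real.sqrt_pos.2 (hμpos i)).ne'
      field_simp
      rw [sq, h2, mul_comm]
    rw [h1, sum_inner, ← e.sum_inner_mul_inner]
    refine Finset.sum_congr rfl fun i _ => ?_
    have h4 : inner ℝ (e i) (S w) = (Real.sqrt (μ i))⁻¹ * inner ℝ (e i) w := by
      rw [hS, inner_sum]
      simp [inner_smul_right, hei]
    rw [inner_smul_left, h4, RCLike.conj_to_real, real_inner_comm]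
    have h3 := (Real.sqrt_pos.2 (hμpos i)).ne'
    field_simp

/-- The operator `(NᵀN)^{-1/2}` of an injective linear map `N`; arbitrary if `N` is not
injective. -/
def normalizer (N : Z →L[ℝ] W) : Z →L[ℝ] Z :=
  Classical.epsilon fun S => IsNormalizer N S

lemma isNormalizer_normalizer {N : Z →L[ℝ] W} (hN : Function.Injective N) :
    IsNormalizer N (normalizer N) :=
  Classical.epsilon_spec (exists_isNormalizer hN)

/-- The normalizer is equivariant under isometries of the source. -/
lemma normalizer_comp_isometry {N : Z →L[ℝ] W} (hN : Function.Injective N) (T : Z ≃ₗᵢ[ℝ] Z)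
    {N' : Z →L[ℝ] W} (hN' : ∀ z, N' z = N (T z)) (z : Z) :
    T (normalizer N' z) = normalizer N (T z) := by
  have h := isNormalizer_normalizer hN
  let T' : Z →L[ℝ] Z := (T.toContinuousLinearEquiv : Z →L[ℝ] Z)
  let T'' : Z →L[ℝ] Z := (T.symm.toContinuousLinearEquiv : Z →L[ℝ] Z)
  have hN'i : Function.Injective N' := fun a c hac => by
    rw [hN', hN'] at hac
    exact T.injective (hN hac)
  have h' : IsNormalizer N' (T'' ∘L normalizer N ∘L T') := by
    have hT : ∀ v, (T'' ∘L normalizer N ∘L T') v = T.symm (normalizer N (T v)) := fun v => rfl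
    have hin : ∀ v w, inner ℝ (T.symm v) w = inner ℝ v (T w) := fun v w => by
      rw [← T.inner_map_map, T.apply_symm_apply]
    refine ⟨⟨fun v w => ?_, fun v hv => ?_⟩, fun v w => ?_⟩
    · simp only [ContinuousLinearMap.coe_coe]
      rw [hT, hT, hin, real_inner_comm _ v, hin, real_inner_comm (T v)]
      exact h.symm _ _
    · rw [hT, hin]
      exact h.pos _ fun h0 => hv (T.injective (h0.trans (map_zero T).symm))
    · rw [hT, hT, hN', hN', T.apply_symm_apply, T.apply_symm_apply, h.isometry, T.inner_map_map]
  rw [(isNormalizer_normalizer hN'i).unique h']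
  exact T.apply_symm_apply _

lemma IsPosDefOp.exists_lower_bound {R : Z →L[ℝ] Z} (hR : IsPosDefOp R) :
    ∃ c > 0, ∀ v, c * ‖v‖ ^ 2 ≤ inner ℝ (R v) v := by
  rcases subsingleton_or_nontrivial Z with hZ | hZ
  · exact ⟨1, one_pos, fun v => by simp [Subsingleton.elim v 0]⟩
  have hc : ContinuousOn (fun v => inner ℝ (R v) v) (Metric.sphere (0 : Z) 1) := by fun_prop
  obtain ⟨u, hu, hmin⟩ := (isCompact_sphere (0 : Z) 1).exists_isMinOn
    (NormedSpace.sphere_nonempty.2 zero_le_one) hc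
  refine ⟨inner ℝ (R u) u, hR.pos u (Metric.ne_of_mem_sphere hu one_ne_zero), fun v => ?_⟩
  by_cases hv : v = 0
  · simp [hv]
  have hn : 0 < ‖v‖ := norm_pos_iff.2 hv
  have h1 : (inner ℝ (R u) u : ℝ) ≤ inner ℝ (R (‖v‖⁻¹ • v)) (‖v‖⁻¹ • v) :=
    hmin (by simp [norm_smul, hn.ne'])
  rw [map_smul, inner_smul_left, inner_smul_right, RCLike.conj_to_real] at h1
  calc inner ℝ (R u) u * ‖v‖ ^ 2
      ≤ (‖v‖⁻¹ * (‖v‖⁻¹ * inner ℝ (R v) v)) * ‖v‖ ^ 2 := by gcongr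
    _ = inner ℝ (R v) v := by field_simp

lemma IsPosDefOp.eventually {R : Z →L[ℝ] Z} (hR : IsPosDefOp R) :
    ∀ᶠ R' : Z →L[ℝ] Z in 𝓝 R, ∀ v, v ≠ 0 → 0 < inner ℝ (R' v) v := by
  obtain ⟨c, hc, h⟩ := hR.exists_lower_bound
  filter_upwards [Metric.ball_mem_nhds R hc] with R' hR' v hv
  have hn : 0 < ‖v‖ := norm_pos_iff.2 hv
  have h1 : ‖R' - R‖ < c := by simpa [dist_eq_norm] using hR'
  have h2 : |inner ℝ ((R' - R) v) v| ≤ ‖R' - R‖ * ‖v‖ * ‖v‖ :=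
    (abs_real_inner_le_norm _ _).trans (by gcongr; exact (R' - R).le_opNorm v)
  have h3 : inner ℝ (R' v) v = inner ℝ (R v) v + inner ℝ ((R' - R) v) v := by
    rw [← inner_add_left]; simp
  have h4 := h v
  have h5 : ‖R' - R‖ * ‖v‖ * ‖v‖ < c * ‖v‖ * ‖v‖ := by gcongr
  have h6 := (abs_le.1 h2).1
  rw [h3]
  nlinarith

/-- The inverse square root is smooth near a positive definite operator, by the inverse function
theorem for `R ↦ R²`: the linearization at `R₀` is the Sylvester operator `H ↦ R₀ H + H R₀`. -/
lemma exists_contDiffAt_invSqrt {S₀ Q₀ : Z →L[ℝ] Z} (hS : IsPosDefOp S₀)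
    (hQ : S₀ * Q₀ * S₀ = 1) {n : ℕ∞ω} (hn : n ≠ 0) :
    ∃ σ : (Z →L[ℝ] Z) → (Z →L[ℝ] Z), ContDiffAt ℝ n σ Q₀ ∧
      ∀ᶠ Q in 𝓝 Q₀, IsSelfAdjoint Q → IsPosDefOp (σ Q) ∧ σ Q * Q * σ Q = 1 := by
  set R₀ : Z →L[ℝ] Z := Q₀ * S₀ with hR₀
  have hSR : S₀ * R₀ = 1 := by rw [hR₀, ← mul_assoc, hQ]
  have hRS : R₀ * S₀ = 1 := clm_mul_eq_one_comm hSR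
  have hRsq : R₀ * R₀ = Q₀ := by
    calc R₀ * R₀ = Q₀ * (S₀ * Q₀ * S₀) := by simp only [hR₀, mul_assoc]
      _ = Q₀ := by rw [hQ, mul_one]
  have hSRv : ∀ v, S₀ (R₀ v) = v := fun v => congrArg (fun T : Z →L[ℝ] Z => T v) hSR
  have hR : IsPosDefOp R₀ := by
    refine ⟨fun v w => ?_, fun v hv => ?_⟩
    · simp only [ContinuousLinearMap.coe_coe]
      have := hS.symm (R₀ v) (R₀ w)
      simp only [ContinuousLinearMap.coe_coe, hSRv] at this
      exact this.symm
    · have h1 := hS.pos (R₀ v) fun h0 => hv (by rw [← hSRv v, h0, map_zero])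
      rwa [hSRv, real_inner_comm] at h1
  let u : (Z →L[ℝ] Z)ˣ := ⟨R₀, S₀, hRS, hSR⟩
  let f : (Z →L[ℝ] Z) → (Z →L[ℝ] Z) := fun R => R * R
  let f₀ : (Z →L[ℝ] Z) →L[ℝ] (Z →L[ℝ] Z) :=
    R₀ • ContinuousLinearMap.id ℝ _ + MulOpposite.op R₀ • ContinuousLinearMap.id ℝ _
  have hf₀ : ∀ H, f₀ H = R₀ * H + H * R₀ := fun H => rfl
  have hinj : Function.Injective f₀.toLinearMap := by
    refine (injective_iff_map_eq_zero f₀.toLinearMap).2 fun H hH => ?_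
    exact hR.eq_zero_of_sylvester hR hH
  let f' : (Z →L[ℝ] Z) ≃L[ℝ] (Z →L[ℝ] Z) :=
    (LinearEquiv.ofInjectiveEndo f₀.toLinearMap hinj).toContinuousLinearEquiv
  have hf' : (f' : (Z →L[ℝ] Z) →L[ℝ] (Z →L[ℝ] Z)) = f₀ := by ext1 H; rfl
  have hder : HasFDerivAt f (f' : (Z →L[ℝ] Z) →L[ℝ] (Z →L[ℝ] Z)) R₀ := by
    rw [hf']
    exact (hasFDerivAt_id R₀).mul' (hasFDerivAt_id R₀)
  have hcd : ContDiffAt ℝ n f R₀ := contDiffAt_id.mul contDiffAt_id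
  set r := hcd.localInverse hder hn with hr
  have hrc : ContDiffAt ℝ n r Q₀ := by
    have := hcd.to_localInverse hder hn
    rwa [show f R₀ = Q₀ from hRsq] at this
  have hstrict := hcd.hasStrictFDerivAt' hder hn
  have hr₀ : r Q₀ = R₀ := by
    have := hcd.localInverse_apply_image hder hn
    rwa [show f R₀ = Q₀ from hRsq] at this
  have hright : ∀ᶠ Q in 𝓝 Q₀, r Q * r Q = Q := by
    have := hstrict.eventually_right_inverse
    rwa [show f R₀ = Q₀ from hRsq] at this
  have hleft : ∀ᶠ R in 𝓝 R₀, r (R * R) = R := hstrict.eventually_left_inverse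
  have hR₀star : star R₀ = R₀ := (ContinuousLinearMap.isSelfAdjoint_iff_isSymmetric.2 hR.symm)
  have htend : Tendsto r (𝓝 Q₀) (𝓝 R₀) := hr₀ ▸ hrc.continuousAt.tendsto
  have htend' : Tendsto (fun Q => star (r Q)) (𝓝 Q₀) (𝓝 R₀) := by
    have := (continuous_star.tendsto R₀).comp htend
    rwa [hR₀star] at this
  refine ⟨fun Q => Ring.inverse (r Q), ?_, ?_⟩
  · have hinv : ContDiffAt ℝ n (Ring.inverse : (Z →L[ℝ] Z) → (Z →L[ℝ] Z)) (r Q₀) := by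
      rw [hr₀]
      exact contDiffAt_ringInverse ℝ u
    exact ContDiffAt.comp (f := r) Q₀ hinv hrc
  · have hunit : ∀ᶠ R in 𝓝 R₀, IsUnit R := u.nhds
    filter_upwards [hright, htend'.eventually hleft, htend.eventually hR.eventually,
      htend.eventually hunit] with Q h1 h2 h3 h4 hQsa
    have hsa : star (r Q) = r Q := by
      rw [← h2, ← star_mul, h1, hQsa.star_eq]
    have hsymm : (r Q).toLinearMap.IsSymmetric :=
      ContinuousLinearMap.isSelfAdjoint_iff_isSymmetric.1 hsa
    have h5 : r Q * Ring.inverse (r Q) = 1 := Ring.mul_inverse_cancel _ h4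
    have h6 : Ring.inverse (r Q) * r Q = 1 := Ring.inverse_mul_cancel _ h4
    have h5v : ∀ v, r Q (Ring.inverse (r Q) v) = v :=
      fun v => congrArg (fun T : Z →L[ℝ] Z => T v) h5
    refine ⟨⟨fun v w => ?_, fun v hv => ?_⟩, ?_⟩
    · have := hsymm (Ring.inverse (r Q) v) (Ring.inverse (r Q) w)
      simp only [ContinuousLinearMap.coe_coe, h5v] at this ⊢
      exact this.symm
    · have h7 := h3 (Ring.inverse (r Q) v) fun h0 => hv (by rw [← h5v v, h0, map_zero])
      rwa [h5v, real_inner_comm] at h7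
    · calc Ring.inverse (r Q) * Q * Ring.inverse (r Q)
          = (Ring.inverse (r Q) * r Q) * (r Q * Ring.inverse (r Q)) := by
            conv_lhs => rw [← h1]
            simp only [mul_assoc]
            rw [h1]
        _ = 1 := by rw [h5, h6, one_mul]

variable {𝓔 : Type*} [NormedAddCommGroup 𝓔] [NormedSpace ℝ 𝓔]

/-- The normalizer depends smoothly on an injective linear map. -/
theorem ContDiffWithinAt.normalizer {N : 𝓔 → Z →L[ℝ] W} {s : Set 𝓔} {x : 𝓔} {n : ℕ∞ω}
    (hN : ContDiffWithinAt ℝ n N s x) (hx : x ∈ s) (hinj : Function.Injective (N x)) (hn : n ≠ 0) :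
    ContDiffWithinAt ℝ n (fun y => normalizer (N y)) s x := by
  have h₀ := isNormalizer_normalizer hinj
  set Q : 𝓔 → Z →L[ℝ] Z := fun y => ContinuousLinearMap.adjoint (N y) ∘L N y
  have hQ : ContDiffWithinAt ℝ n Q s x := by
    have h1 : ContDiff ℝ n fun T : Z →L[ℝ] W => ContinuousLinearMap.adjoint T :=
      ContinuousLinearMap.contDiff (𝕜 := ℝ)
        { toFun := fun T : Z →L[ℝ] W => ContinuousLinearMap.adjoint T
          map_add' := fun a c => map_add _ a c
          map_smul' := fun c a => by simp
          cont := (ContinuousLinearMap.adjoint (𝕜 := ℝ) (E := Z) (F := W)).continuous }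
    have h2 : ContDiffWithinAt ℝ n (fun y => ContinuousLinearMap.adjoint (N y)) s x :=
      h1.contDiffAt.comp_contDiffWithinAt x hN
    exact h2.clm_comp hN
  obtain ⟨σ, hσ, hσ'⟩ := exists_contDiffAt_invSqrt h₀.toIsPosDefOp h₀.mul_eq_one hn
  refine (hσ.comp_contDiffWithinAt (f := Q) x hQ).congr_of_eventuallyEq_of_mem ?_ hx
  filter_upwards [hQ.continuousWithinAt.eventually hσ'] with y hy
  have hsa : IsSelfAdjoint (Q y) := by
    refine ContinuousLinearMap.isSelfAdjoint_iff_isSymmetric.2 fun v w => ?_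
    simp only [Q, ContinuousLinearMap.coe_coe, ContinuousLinearMap.comp_apply]
    rw [ContinuousLinearMap.adjoint_inner_left, ContinuousLinearMap.adjoint_inner_right]
  have h1 := isNormalizer_of_mul_eq_one (hy hsa).1 (hy hsa).2
  -- Injectivity of `N y` follows from the invertibility of `Q y = (N y)ᵀ N y`.
  have hNy : Function.Injective (N y) := by
    refine (injective_iff_map_eq_zero (N y)).2 fun v hv => ?_
    have h2 : σ (Q y) * (σ (Q y) * Q y) = 1 := clm_mul_eq_one_comm (hy hsa).2
    have h3 := congrArg (fun T : Z →L[ℝ] Z => T v) h2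
    simpa [Q, hv] using h3.symm
  exact (isNormalizer_normalizer hNy).unique h1

end Normalizer

/-! ### Second derivatives of compositions -/

section ChainRule

open Filter Topology

variable {𝓔 : Type*} [NormedAddCommGroup 𝓔] [NormedSpace ℝ 𝓔]
  {𝓔' : Type*} [NormedAddCommGroup 𝓔'] [NormedSpace ℝ 𝓔']
  {W : Type*} [NormedAddCommGroup W] [InnerProductSpace ℝ W]
  {S : Set 𝓔} {S' : Set 𝓔'}

lemma fderivWithin_fderivWithin_comp {f : 𝓔 → 𝓔'} {g : 𝓔' → W} (hS : UniqueDiffOn ℝ S)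
    (hS' : UniqueDiffOn ℝ S') (hmaps : Set.MapsTo f S S') {x : 𝓔} (hx : x ∈ S)
    (hf : ContDiffWithinAt ℝ 2 f S x) (hg : ContDiffWithinAt ℝ 2 g S' (f x)) (v w : 𝓔) :
    fderivWithin ℝ (fderivWithin ℝ (g ∘ f) S) S x v w =
      fderivWithin ℝ (fderivWithin ℝ g S') S' (f x) (fderivWithin ℝ f S x v)
        (fderivWithin ℝ f S x w)
      + fderivWithin ℝ g S' (f x) (fderivWithin ℝ (fderivWithin ℝ f S) S x v w) := by
  have hgf : ContDiffWithinAt ℝ 2 (g ∘ f) S x := hg.comp x hf hmaps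
  have h11 : (1 : ℕ∞ω) + 1 ≤ 2 := by norm_num [one_add_one_eq_two]
  rw [← fderivWithin_fderivWithin_apply hgf hS hx]
  have ef : ∀ᶠ y in 𝓝[S] x, ContDiffWithinAt ℝ 2 f S y := by
    simpa [Set.insert_eq_of_mem hx] using hf.eventually (by decide)
  have eg : ∀ᶠ y in 𝓝[S] x, ContDiffWithinAt ℝ 2 g S' (f y) := by
    have h1 : ∀ᶠ y in 𝓝[S'] (f x), ContDiffWithinAt ℝ 2 g S' y := by
      simpa [Set.insert_eq_of_mem (hmaps hx)] using hg.eventually (by decide)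
    exact (hf.continuousWithinAt.tendsto_nhdsWithin hmaps).eventually h1
  have e1 : (fun y => fderivWithin ℝ (g ∘ f) S y w) =ᶠ[𝓝[S] x]
      fun y => fderivWithin ℝ g S' (f y) (fderivWithin ℝ f S y w) := by
    filter_upwards [ef, eg, self_mem_nhdsWithin] with y h1 h2 hy
    rw [fderivWithin_comp y (h2.differentiableWithinAt two_ne_zero)
      (h1.differentiableWithinAt two_ne_zero) hmaps (hS y hy)]
    rfl
  rw [e1.fderivWithin_eq_of_mem hx]
  have d1 : HasFDerivWithinAt (fun y => fderivWithin ℝ g S' (f y))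
      ((fderivWithin ℝ (fderivWithin ℝ g S') S' (f x)).comp (fderivWithin ℝ f S x)) S x :=
    (((hg.fderivWithin_right hS' h11 (hmaps hx)).differentiableWithinAt
      one_ne_zero).hasFDerivWithinAt).comp x
      (hf.differentiableWithinAt two_ne_zero).hasFDerivWithinAt hmaps
  have d2 : DifferentiableWithinAt ℝ (fun y => fderivWithin ℝ f S y w) S x :=
    (hf.fderivWithin_apply_const hS hx h11 w).differentiableWithinAt one_ne_zero
  rw [(d1.clm_apply d2.hasFDerivWithinAt).fderivWithin (hS x hx)]
  simp only [_root_.add_apply, ContinuousLinearMap.comp_apply, ContinuousLinearMap.flip_apply]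
  rw [add_comm, fderivWithin_fderivWithin_apply hf hS hx]

end ChainRule

/-! ### The limit of small fibres -/

section Limit

open Filter Topology Matrix

variable {W : Type*} [NormedAddCommGroup W] [InnerProductSpace ℝ W]
  {Z : Type*} [NormedAddCommGroup Z] [InnerProductSpace ℝ Z]
  {𝓑 : Type*} [NormedAddCommGroup 𝓑] [NormedSpace ℝ 𝓑]
  {𝓨 : Type*} [NormedAddCommGroup 𝓨] [NormedSpace ℝ 𝓨]
  {ι : Type*} [Fintype ι] [DecidableEq ι] {ι' : Type*} [Fintype ι'] [DecidableEq ι']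
  {S : Set 𝓑}

/-- The parametrization `(x, y) ↦ (x, ε φ(y))` of the bundle with fibre the `ε`-fold of the image
of `φ`. -/
def shrink (φ : 𝓨 → Z) (ε : ℝ) (p : 𝓑 × 𝓨) : 𝓑 × Z := (p.1, ε • φ p.2)

lemma contDiffAt_shrink {φ : 𝓨 → Z} {p : 𝓑 × 𝓨} {n : ℕ∞ω} (hφ : ContDiffAt ℝ n φ p.2) (ε : ℝ) :
    ContDiffAt ℝ n (shrink φ ε : 𝓑 × 𝓨 → 𝓑 × Z) p :=
  contDiffAt_fst.prodMk ((hφ.comp p contDiffAt_snd).const_smul ε)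

lemma fderivWithin_shrink {φ : 𝓨 → Z} {p : 𝓑 × 𝓨} (hS : UniqueDiffOn ℝ S) (hp : p.1 ∈ S)
    (hφ : DifferentiableAt ℝ φ p.2) (ε : ℝ) (v : 𝓑 × 𝓨) :
    fderivWithin ℝ (shrink φ ε : 𝓑 × 𝓨 → 𝓑 × Z) (S ×ˢ Set.univ) p v =
      (v.1, ε • fderiv ℝ φ p.2 v.2) := by
  have hu : UniqueDiffWithinAt ℝ (S ×ˢ (Set.univ : Set 𝓨)) p :=
    (hS.prod uniqueDiffOn_univ) p ⟨hp, trivial⟩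
  have h1 : HasFDerivAt (shrink φ ε : 𝓑 × 𝓨 → 𝓑 × Z)
      ((ContinuousLinearMap.fst ℝ 𝓑 𝓨).prod
        (ε • (fderiv ℝ φ p.2).comp (ContinuousLinearMap.snd ℝ 𝓑 𝓨))) p :=
    hasFDerivAt_fst.prodMk ((hφ.hasFDerivAt.comp p hasFDerivAt_snd).const_smul ε)
  rw [h1.hasFDerivWithinAt.fderivWithin hu]
  rfl

lemma fderivWithin_fderivWithin_shrink {φ : 𝓨 → Z} {p : 𝓑 × 𝓨} (hS : UniqueDiffOn ℝ S)
    (hp : p.1 ∈ S) (hφ : ContDiffAt ℝ 2 φ p.2) (ε : ℝ) (v w : 𝓑 × 𝓨) :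
    fderivWithin ℝ (fderivWithin ℝ (shrink φ ε : 𝓑 × 𝓨 → 𝓑 × Z) (S ×ˢ Set.univ))
      (S ×ˢ Set.univ) p v w = (0, ε • fderiv ℝ (fderiv ℝ φ) p.2 v.2 w.2) := by
  have hU : UniqueDiffOn ℝ (S ×ˢ (Set.univ : Set 𝓨)) := hS.prod uniqueDiffOn_univ
  have hpU : p ∈ S ×ˢ (Set.univ : Set 𝓨) := ⟨hp, trivial⟩
  rw [← fderivWithin_fderivWithin_apply (contDiffAt_shrink hφ ε).contDiffWithinAt hU hpU]
  have e1 : (fun q => fderivWithin ℝ (shrink φ ε : 𝓑 × 𝓨 → 𝓑 × Z) (S ×ˢ Set.univ) q w)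
      =ᶠ[𝓝[S ×ˢ Set.univ] p] fun q => (w.1, ε • fderiv ℝ φ q.2 w.2) := by
    have h1 : ∀ᶠ q in 𝓝[S ×ˢ (Set.univ : Set 𝓨)] p, ContDiffAt ℝ 2 φ q.2 :=
      nhdsWithin_le_nhds (continuousAt_snd.eventually (hφ.eventually (by decide)))
    filter_upwards [h1, self_mem_nhdsWithin] with q h2 hq
    exact fderivWithin_shrink hS hq.1 (h2.differentiableAt two_ne_zero) ε w
  rw [e1.fderivWithin_eq_of_mem hpU]
  have h2 : HasFDerivAt (fderiv ℝ φ) (fderiv ℝ (fderiv ℝ φ) p.2) p.2 :=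
    ((hφ.fderiv_right (m := 1) (by norm_num [one_add_one_eq_two])).differentiableAt
      one_ne_zero).hasFDerivAt
  have h3 : HasFDerivAt (fun q : 𝓑 × 𝓨 => fderiv ℝ φ q.2 w.2)
      ((ContinuousLinearMap.apply ℝ Z w.2).comp
        ((fderiv ℝ (fderiv ℝ φ) p.2).comp (ContinuousLinearMap.snd ℝ 𝓑 𝓨))) p :=
    (ContinuousLinearMap.apply ℝ Z w.2).hasFDerivAt.comp p (h2.comp p hasFDerivAt_snd)
  have h4 : HasFDerivAt (fun q : 𝓑 × 𝓨 => (w.1, ε • fderiv ℝ φ q.2 w.2))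
      ((0 : 𝓑 × 𝓨 →L[ℝ] 𝓑).prod (ε • (ContinuousLinearMap.apply ℝ Z w.2).comp
        ((fderiv ℝ (fderiv ℝ φ) p.2).comp (ContinuousLinearMap.snd ℝ 𝓑 𝓨)))) p :=
    (hasFDerivAt_const w.1 p).prodMk (h3.const_smul ε)
  rw [h4.hasFDerivWithinAt.fderivWithin (hU p hpU)]
  rfl

/-- As `ε → 0`, the map `(x, y) ↦ Φ (x, ε φ(y))` looks, after rescaling, like a cylinder over the
fibre. Hence it is an immersion of positive scalar curvature near `(x₀, y₀)` for small `ε` if the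
derivative of `Φ` in the fibre direction, projected to the complement of the derivative in the base
direction, is isometric, and `φ` has positive scalar curvature at `y₀`. -/
theorem eventually_shrink_scalar_pos (bA : Module.Basis ι ℝ 𝓑) (bY : Module.Basis ι' ℝ 𝓨)
    (hS : UniqueDiffOn ℝ S) {Φ : 𝓑 × Z → W} {x₀ : 𝓑} (hx₀ : x₀ ∈ S)
    (hΦ : ContDiffWithinAt ℝ 2 Φ (S ×ˢ Set.univ) (x₀, 0)) {φ : 𝓨 → Z} {y₀ : 𝓨}
    (hφ : ContDiffAt ℝ 2 φ y₀)
    (hL : Function.Injective fun a => fderivWithin ℝ Φ (S ×ˢ Set.univ) (x₀, 0) (a, (0 : Z)))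
    (hM : ∀ z z', inner ℝ
      (normalPart (fun i => fderivWithin ℝ Φ (S ×ˢ Set.univ) (x₀, 0) (bA i, (0 : Z)))
        (fderivWithin ℝ Φ (S ×ˢ Set.univ) (x₀, 0) ((0 : 𝓑), z)))
      (normalPart (fun i => fderivWithin ℝ Φ (S ×ˢ Set.univ) (x₀, 0) (bA i, (0 : Z)))
        (fderivWithin ℝ Φ (S ×ˢ Set.univ) (x₀, 0) ((0 : 𝓑), z'))) = inner ℝ z z')
    (hφ₁ : Function.Injective (fderiv ℝ φ y₀))
    (hscal : 0 < jetScal bY (fderiv ℝ φ y₀) (fderiv ℝ (fderiv ℝ φ) y₀)) :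
    ∀ᶠ q : ℝ × (𝓑 × 𝓨) in 𝓝[>] 0 ×ˢ 𝓝[S ×ˢ Set.univ] (x₀, y₀),
      ContDiffWithinAt ℝ 2 (Φ ∘ shrink φ q.1) (S ×ˢ Set.univ) q.2 ∧
      Function.Injective (fderivWithin ℝ (Φ ∘ shrink φ q.1) (S ×ˢ Set.univ) q.2) ∧
      0 < jetScal (bA.prod bY) (fderivWithin ℝ (Φ ∘ shrink φ q.1) (S ×ˢ Set.univ) q.2)
        (fderivWithin ℝ (fderivWithin ℝ (Φ ∘ shrink φ q.1) (S ×ˢ Set.univ)) (S ×ˢ Set.univ) q.2)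
    := by
  set U : Set (𝓑 × Z) := S ×ˢ Set.univ with hU_def
  set V : Set (𝓑 × 𝓨) := S ×ˢ Set.univ with hV_def
  have hU : UniqueDiffOn ℝ U := hS.prod uniqueDiffOn_univ
  have hV : UniqueDiffOn ℝ V := hS.prod uniqueDiffOn_univ
  have h11 : (1 : ℕ∞ω) + 1 ≤ 2 := by norm_num [one_add_one_eq_two]
  have h₀U : ((x₀, 0) : 𝓑 × Z) ∈ U := ⟨hx₀, trivial⟩
  set b := bA.prod bY with hb
  set l : Filter (ℝ × (𝓑 × 𝓨)) := 𝓝[>] 0 ×ˢ 𝓝[V] (x₀, y₀) with hl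
  let j : ℝ × (𝓑 × 𝓨) → 𝓑 × Z := fun q => shrink φ q.1 q.2
  have tε : Tendsto (fun q : ℝ × (𝓑 × 𝓨) => q.1) l (𝓝 0) :=
    tendsto_fst.mono_right nhdsWithin_le_nhds
  have tp : Tendsto (fun q : ℝ × (𝓑 × 𝓨) => q.2) l (𝓝 (x₀, y₀)) :=
    tendsto_snd.mono_right nhdsWithin_le_nhds
  have ty : Tendsto (fun q : ℝ × (𝓑 × 𝓨) => q.2.2) l (𝓝 y₀) := (continuousAt_snd.tendsto).comp tp
  have eV : ∀ᶠ q in l, q.2 ∈ V := tendsto_snd.eventually self_mem_nhdsWithin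
  have tj : Tendsto j l (𝓝[U] (x₀, 0)) := by
    refine tendsto_nhdsWithin_iff.2 ⟨?_, eV.mono fun q hq => ⟨hq.1, trivial⟩⟩
    have h1 : Tendsto (fun q : ℝ × (𝓑 × 𝓨) => q.1 • φ q.2.2) l (𝓝 ((0 : ℝ) • φ y₀)) :=
      tε.smul (hφ.continuousAt.tendsto.comp ty)
    rw [zero_smul] at h1
    exact ((continuousAt_fst.tendsto).comp tp).prodMk_nhds h1
  have tDΦ : Tendsto (fun q => fderivWithin ℝ Φ U (j q)) l (𝓝 (fderivWithin ℝ Φ U (x₀, 0))) :=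
    ((hΦ.fderivWithin_right (m := 1) hU h11 h₀U).continuousWithinAt.tendsto).comp tj
  have tD2Φ : Tendsto (fun q => fderivWithin ℝ (fderivWithin ℝ Φ U) U (j q)) l
      (𝓝 (fderivWithin ℝ (fderivWithin ℝ Φ U) U (x₀, 0))) :=
    (((hΦ.fderivWithin_right (m := 1) hU h11 h₀U).fderivWithin_right (m := 0) hU
      (by norm_num) h₀U).continuousWithinAt.tendsto).comp tj
  have tφ₁ : Tendsto (fun q : ℝ × (𝓑 × 𝓨) => fderiv ℝ φ q.2.2) l (𝓝 (fderiv ℝ φ y₀)) :=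
    (hφ.fderiv_right (m := 1) h11).continuousAt.tendsto.comp ty
  have tφ₂ : Tendsto (fun q : ℝ × (𝓑 × 𝓨) => fderiv ℝ (fderiv ℝ φ) q.2.2) l
      (𝓝 (fderiv ℝ (fderiv ℝ φ) y₀)) :=
    ((hφ.fderiv_right (m := 1) h11).fderiv_right (m := 0) (by norm_num)).continuousAt.tendsto.comp ty
  -- The rescaled first and second derivatives.
  let P : ℝ × (𝓑 × 𝓨) → 𝓑 × 𝓨 → 𝓑 × Z := fun q v => (v.1, fderiv ℝ φ q.2.2 v.2)
  let d : ℝ × (𝓑 × 𝓨) → ι ⊕ ι' → W := fun q p => fderivWithin ℝ Φ U (j q) (P q (b p))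
  let s : ℝ × (𝓑 × 𝓨) → ι ⊕ ι' → ι ⊕ ι' → W := fun q p p' =>
    q.1 • fderivWithin ℝ (fderivWithin ℝ Φ U) U (j q) (P q (b p)) (P q (b p'))
      + fderivWithin ℝ Φ U (j q) (0, fderiv ℝ (fderiv ℝ φ) q.2.2 (b p).2 (b p').2)
  let L : 𝓑 →L[ℝ] W := (fderivWithin ℝ Φ U (x₀, 0)).comp (ContinuousLinearMap.inl ℝ 𝓑 Z)
  let M : Z →L[ℝ] W := (fderivWithin ℝ Φ U (x₀, 0)).comp (ContinuousLinearMap.inr ℝ 𝓑 Z)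
  let D₀ : 𝓑 × 𝓨 →L[ℝ] W := L.comp (ContinuousLinearMap.fst ℝ 𝓑 𝓨)
    + (M.comp (fderiv ℝ φ y₀)).comp (ContinuousLinearMap.snd ℝ 𝓑 𝓨)
  let s₀ : 𝓑 × 𝓨 →L[ℝ] 𝓑 × 𝓨 →L[ℝ] W := (ContinuousLinearMap.compL ℝ (𝓑 × 𝓨) Z W M).comp
    ((fderiv ℝ (fderiv ℝ φ) y₀).bilinearComp (ContinuousLinearMap.snd ℝ 𝓑 𝓨)
      (ContinuousLinearMap.snd ℝ 𝓑 𝓨))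
  have hcyl := jetScal_cylinder bA bY (L := L) hL (M := M) hM hφ₁
    (φ₂ := fderiv ℝ (fderiv ℝ φ) y₀) (D := D₀) (fun a y => rfl) (s := s₀) (fun a y a' y' => rfl)
  have tP : ∀ v, Tendsto (fun q => P q v) l (𝓝 (v.1, fderiv ℝ φ y₀ v.2)) := fun v =>
    tendsto_const_nhds.prodMk_nhds (tφ₁.clm_apply' tendsto_const_nhds)
  have td : ∀ p, Tendsto (fun q => d q p) l (𝓝 (D₀ (b p))) := by
    intro p
    have h1 : D₀ (b p) = fderivWithin ℝ Φ U (x₀, 0) ((b p).1, fderiv ℝ φ y₀ (b p).2) := by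
      have h2 : (((b p).1, fderiv ℝ φ y₀ (b p).2) : 𝓑 × Z) =
          ((b p).1, 0) + (0, fderiv ℝ φ y₀ (b p).2) := by simp
      rw [h2, map_add]; rfl
    rw [h1]
    exact tDΦ.clm_apply' (tP _)
  have ts : ∀ p p', Tendsto (fun q => s q p p') l (𝓝 (s₀ (b p) (b p'))) := by
    intro p p'
    have h1 := tε.smul ((tD2Φ.clm_apply' (tP (b p))).clm_apply' (tP (b p')))
    have h2 : Tendsto (fun q : ℝ × (𝓑 × 𝓨) =>
        ((0 : 𝓑), fderiv ℝ (fderiv ℝ φ) q.2.2 (b p).2 (b p').2)) l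
        (𝓝 (0, fderiv ℝ (fderiv ℝ φ) y₀ (b p).2 (b p').2)) :=
      tendsto_const_nhds.prodMk_nhds
        ((tφ₂.clm_apply' tendsto_const_nhds).clm_apply' tendsto_const_nhds)
    have h3 := h1.add (tDΦ.clm_apply' h2)
    rw [zero_smul, zero_add] at h3
    exact h3
  have hpos : ∀ᶠ q in l, LinearIndependent ℝ (d q) ∧ 0 < gaussScal (d q) (s q) := by
    have h1 := tendsto_gaussScal (linearIndependent_of_injective b hcyl.1) td ts
    have h2 := eventually_linearIndependent (linearIndependent_of_injective b hcyl.1) td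
    refine h2.and (h1.eventually_const_lt ?_)
    exact lt_of_lt_of_eq hscal hcyl.2.symm
  have eΦ : ∀ᶠ q in l, ContDiffWithinAt ℝ 2 Φ U (j q) := by
    refine tj.eventually ?_
    simpa [Set.insert_eq_of_mem h₀U] using hΦ.eventually (by decide)
  have eφ : ∀ᶠ q : ℝ × (𝓑 × 𝓨) in l, ContDiffAt ℝ 2 φ q.2.2 :=
    ty.eventually (hφ.eventually (by decide))
  have eε : ∀ᶠ q : ℝ × (𝓑 × 𝓨) in l, 0 < q.1 := tendsto_fst.eventually self_mem_nhdsWithin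
  filter_upwards [hpos, eΦ, eφ, eε, eV] with q hq hqΦ hqφ hqε hqV
  have hmaps : Set.MapsTo (shrink φ q.1) V U := fun p hp => ⟨hp.1, trivial⟩
  have hsh : ContDiffWithinAt ℝ 2 (shrink φ q.1 : 𝓑 × 𝓨 → 𝓑 × Z) V q.2 :=
    (contDiffAt_shrink hqφ q.1).contDiffWithinAt
  have hD : ∀ v, fderivWithin ℝ (Φ ∘ shrink φ q.1) V q.2 v =
      fderivWithin ℝ Φ U (j q) (v.1, q.1 • fderiv ℝ φ q.2.2 v.2) := by
    intro v
    rw [fderivWithin_comp q.2 (hqΦ.differentiableWithinAt two_ne_zero)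
      (hsh.differentiableWithinAt two_ne_zero) hmaps (hV _ hqV), ContinuousLinearMap.comp_apply,
      fderivWithin_shrink hS hqV.1 (hqφ.differentiableAt two_ne_zero)]
  have hs : ∀ v w, fderivWithin ℝ (fderivWithin ℝ (Φ ∘ shrink φ q.1) V) V q.2 v w =
      fderivWithin ℝ (fderivWithin ℝ Φ U) U (j q) (v.1, q.1 • fderiv ℝ φ q.2.2 v.2)
        (w.1, q.1 • fderiv ℝ φ q.2.2 w.2)
      + fderivWithin ℝ Φ U (j q) (0, q.1 • fderiv ℝ (fderiv ℝ φ) q.2.2 v.2 w.2) := by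
    intro v w
    rw [fderivWithin_fderivWithin_comp hV hU hmaps hqV hsh hqΦ,
      fderivWithin_shrink hS hqV.1 (hqφ.differentiableAt two_ne_zero),
      fderivWithin_shrink hS hqV.1 (hqφ.differentiableAt two_ne_zero),
      fderivWithin_fderivWithin_shrink hS hqV.1 hqφ]
  -- On the product basis, passing to the rescaled derivatives is a diagonal change of basis.
  let c : ι ⊕ ι' → ℝ := Sum.elim (fun _ => 1) fun _ => q.1
  have hcP : ∀ p, (((b p).1, q.1 • fderiv ℝ φ q.2.2 (b p).2) : 𝓑 × Z) = c p • P q (b p) := by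
    rintro (i | a)
    · simp [c, P, hb]
    · simp [c, P, hb]
  have hc2 : ∀ p p', q.1 • fderiv ℝ (fderiv ℝ φ) q.2.2 (b p).2 (b p').2 =
      (q.1⁻¹ * (c p * c p')) • fderiv ℝ (fderiv ℝ φ) q.2.2 (b p).2 (b p').2 := by
    rintro (i | a) (i' | a')
    · simp [hb]
    · simp [hb]
    · simp [hb]
    · simp only [c, Sum.elim_inr]
      rw [inv_mul_cancel_left₀ hqε.ne']
  have hc0 : ∀ p, c p ≠ 0 := by
    rintro (i | a)
    · exact one_ne_zero
    · exact hqε.ne'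
  have hDb : ∀ p, fderivWithin ℝ (Φ ∘ shrink φ q.1) V q.2 (b p) = c p • d q p := by
    intro p
    rw [hD, hcP, map_smul]
  have hsb : ∀ p p', fderivWithin ℝ (fderivWithin ℝ (Φ ∘ shrink φ q.1) V) V q.2 (b p) (b p') =
      (c p * c p') • (q.1⁻¹ • s q p p') := by
    intro p p'
    have h1 : ∀ z : Z, ∀ r : ℝ, ((0, r • z) : 𝓑 × Z) = r • (0, z) := fun z r => by simp
    have h2 : ∀ (T : 𝓑 × Z →L[ℝ] 𝓑 × Z →L[ℝ] W) (r r' : ℝ) (u u' : 𝓑 × Z),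
        T (r • u) (r' • u') = (r * r') • T u u' := fun T r r' u u' => by
      rw [T.map_smul, _root_.smul_apply, (T u).map_smul, smul_smul]
    rw [hs, hcP, hcP, hc2, h1, h2, map_smul]
    simp only [s, smul_add, smul_smul]
    congr 2
    · field_simp
    · ring
  refine ⟨hqΦ.comp q.2 hsh hmaps, ?_, ?_⟩
  · refine injective_of_linearIndependent b ?_
    simp only [hDb]
    exact hq.1.units_smul (fun p => Units.mk0 (c p) (hc0 p))
  · have h1 : jetScal b (fderivWithin ℝ (Φ ∘ shrink φ q.1) V q.2)
        (fderivWithin ℝ (fderivWithin ℝ (Φ ∘ shrink φ q.1) V) V q.2) =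
        gaussScal (d q) fun p p' => q.1⁻¹ • s q p p' := by
      refine gaussScal_change (diagonal c) (diagonal fun p => (c p)⁻¹) ?_ ?_ hq.1 ?_ ?_
      · rw [diagonal_mul_diagonal, ← diagonal_one]
        congr 1; ext p; exact mul_inv_cancel₀ (hc0 p)
      · rw [diagonal_mul_diagonal, ← diagonal_one]
        congr 1; ext p; exact inv_mul_cancel₀ (hc0 p)
      · intro p
        rw [hDb]
        simp [diagonal_apply, ite_smul]
      · intro p p'
        rw [hsb]
        simp [diagonal_apply, ite_smul]
    rw [h1, gaussScal_smul]
    exact mul_pos (pow_pos (inv_pos.2 hqε) 2) hq.2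

end Limit

/-! ### The scalar curvature of an immersed manifold in charts -/

section ManifoldScalar

open Filter Topology Set

variable {𝓔 : Type*} [NormedAddCommGroup 𝓔] [NormedSpace ℝ 𝓔] [FiniteDimensional ℝ 𝓔]
  {H : Type*} [TopologicalSpace H] {I : ModelWithCorners ℝ 𝓔 H}
  {M : Type*} [TopologicalSpace M] [ChartedSpace H M]
  {W : Type*} [NormedAddCommGroup W] [InnerProductSpace ℝ W]

lemma ContMDiffAt.contDiffWithinAt_chart {V : Type*} [NormedAddCommGroup V] [NormedSpace ℝ V]
    {f : M → V} {p : M} {n : ℕ∞ω}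
    (hf : ContMDiffAt I 𝓘(ℝ, V) n f p) :
    ContDiffWithinAt ℝ n (f ∘ (extChartAt I p).symm) (range I) (extChartAt I p p) := by
  have := (contMDiffAt_iff.1 hf).2
  simpa only [extChartAt_model_space_eq_id, PartialEquiv.refl_coe, Function.id_comp] using this

lemma MDifferentiableAt.mfderiv_eq_chart {V : Type*} [NormedAddCommGroup V] [NormedSpace ℝ V]
    {f : M → V} {p : M} (hf : MDifferentiableAt I 𝓘(ℝ, V) f p) :
    mfderiv I 𝓘(ℝ, V) f p =
      fderivWithin ℝ (f ∘ (extChartAt I p).symm) (range I) (extChartAt I p p) := by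
  rw [hf.mfderiv]
  rfl

/-- The scalar curvature of the metric induced by an immersion, in terms of the first and second
derivatives of the immersion in a chart. -/
theorem scalarCurvature_inducedMetric [IsManifold I ∞ M] {f : M → W}
    (hf : ContMDiff I 𝓘(ℝ, W) ∞ f) {p : M} (hp : Function.Injective (mfderiv I 𝓘(ℝ, W) f p)) :
    scalarCurvature I (inducedMetric I f) p =
      jetScal (Module.finBasis ℝ 𝓔)
        (fderivWithin ℝ (f ∘ (extChartAt I p).symm) (range I) (extChartAt I p p))
        (fderivWithin ℝ (fderivWithin ℝ (f ∘ (extChartAt I p).symm) (range I)) (range I)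
          (extChartAt I p p)) := by
  have : IsManifold I 1 M := IsManifold.of_le (n := ∞) (by decide)
  have hd : MDifferentiable I 𝓘(ℝ, W) f := hf.mdifferentiable (by decide)
  refine coordScalarCurvature_eq_gaussScal (x := extChartAt I p p) _ I.uniqueDiffOn
    I.range_subset_closure_interior (mem_range_self _)
    ((hf p).contDiffWithinAt_chart.of_le (by decide)) ?_ ?_
  · rw [← (hd p).mfderiv_eq_chart]
    exact linearIndependent_of_injective (𝓔 := 𝓔) (W := W) (Module.finBasis ℝ 𝓔) hp
  · filter_upwards [extChartAt_target_mem_nhdsWithin (I := I) p, self_mem_nhdsWithin]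
      with y hy hyI v w
    have h1 := mfderiv_comp_mfderivWithin (I := 𝓘(ℝ, 𝓔)) (I' := I) (I'' := 𝓘(ℝ, W)) y
      (hd ((extChartAt I p).symm y))
      (mdifferentiableWithinAt_extChartAt_symm hy) (I.uniqueDiffOn.uniqueMDiffOn y hyI)
    rw [mfderivWithin_eq_fderivWithin] at h1
    rw [h1]
    rfl

/-- If `f = Ψ ∘ Θ` near `p`, where the derivative of `Θ` at `p` is injective and hence invertible,
then the scalar curvature of `f` at `p` may be computed from the derivatives of `Ψ`. -/
theorem scalarCurvature_eq_jetScal_of_comp [IsManifold I ∞ M] {f : M → W}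
    (hf : ContMDiff I 𝓘(ℝ, W) ∞ f) {p : M} {S : Set 𝓔} (hS : UniqueDiffOn ℝ S) {Θ : M → 𝓔}
    {Ψ : 𝓔 → W} (hΘ : ContMDiffAt I 𝓘(ℝ, 𝓔) 2 Θ p) (hΘS : ∀ q, Θ q ∈ S)
    (hΘ' : Function.Injective (mfderiv I 𝓘(ℝ, 𝓔) Θ p)) (hΨ : ContDiffWithinAt ℝ 2 Ψ S (Θ p))
    (hΨ' : Function.Injective (fderivWithin ℝ Ψ S (Θ p))) (hfΨ : f =ᶠ[𝓝 p] Ψ ∘ Θ)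
    {ι : Type*} [Fintype ι] [DecidableEq ι] (b : Module.Basis ι ℝ 𝓔) :
    Function.Injective (mfderiv I 𝓘(ℝ, W) f p) ∧
    scalarCurvature I (inducedMetric I f) p =
      jetScal b (fderivWithin ℝ Ψ S (Θ p)) (fderivWithin ℝ (fderivWithin ℝ Ψ S) S (Θ p)) := by
  set x := extChartAt I p p with hx
  have hxI : x ∈ range I := mem_range_self _
  have hpx : (extChartAt I p).symm x = p := extChartAt_to_inv p
  set θ : 𝓔 → 𝓔 := Θ ∘ (extChartAt I p).symm with hθ
  have hθx : θ x = Θ p := congrArg Θ hpx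
  have cθ : ContDiffWithinAt ℝ 2 θ (range I) x := hΘ.contDiffWithinAt_chart
  have hmaps : MapsTo θ (range I) S := fun y _ => hΘS _
  rw [← hθx] at hΨ hΨ' ⊢
  have e1 : (f ∘ (extChartAt I p).symm) =ᶠ[𝓝[range I] x] Ψ ∘ θ := by
    have h1 : Tendsto (extChartAt I p).symm (𝓝[range I] x) (𝓝 p) := by
      have := (continuousAt_extChartAt_symm (I := I) p).tendsto
      rw [extChartAt_to_inv] at this
      exact this.mono_left nhdsWithin_le_nhds
    exact h1.eventually hfΨ
  have hΘd : mfderiv I 𝓘(ℝ, 𝓔) Θ p = fderivWithin ℝ θ (range I) x :=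
    (hΘ.mdifferentiableAt two_ne_zero).mfderiv_eq_chart
  have hθ' : Function.Injective (fderivWithin ℝ θ (range I) x) := by
    rw [← hΘd]; exact hΘ'
  have hfd : fderivWithin ℝ (f ∘ (extChartAt I p).symm) (range I) x =
      (fderivWithin ℝ Ψ S (θ x)).comp (fderivWithin ℝ θ (range I) x) := by
    rw [e1.fderivWithin_eq_of_mem hxI]
    exact fderivWithin_comp x (hΨ.differentiableWithinAt two_ne_zero)
      (cθ.differentiableWithinAt two_ne_zero) hmaps (I.uniqueDiffOn x hxI)
  have hinj : Function.Injective (mfderiv I 𝓘(ℝ, W) f p) := by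
    rw [((hf p).mdifferentiableAt (by decide)).mfderiv_eq_chart, hfd]
    exact hΨ'.comp hθ'
  refine ⟨hinj, ?_⟩
  rw [scalarCurvature_inducedMetric hf hinj]
  refine jetScal_comp b (Module.finBasis ℝ 𝓔)
    (LinearEquiv.ofInjectiveEndo (fderivWithin ℝ θ (range I) x).toLinearMap hθ') hΨ' ?_ ?_
  · intro v
    rw [hfd]; rfl
  · intro v w
    have e2 := e1.fderivWithin' (𝕜 := ℝ) (t := range I) subset_rfl
    rw [e2.fderivWithin_eq_of_mem hxI,
      fderivWithin_fderivWithin_comp I.uniqueDiffOn hS hmaps hxI cθ hΨ]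
    refine ⟨fderivWithin ℝ (fderivWithin ℝ θ (range I)) (range I) x v w, ?_⟩
    simp

/-- If a map with injective differential factors locally through `Θ`, then `Θ` has injective
differential. -/
lemma injective_mfderiv_of_comp {E' : Type*} [NormedAddCommGroup E'] [NormedSpace ℝ E']
    {H' : Type*} [TopologicalSpace H'] {I' : ModelWithCorners ℝ E' H'}
    {N : Type*} [TopologicalSpace N] [ChartedSpace H' N] {V : Type*} [NormedAddCommGroup V]
    [NormedSpace ℝ V] {i : M → N} {p : M} (hi : Function.Injective (mfderiv I I' i p))
    {S : Set V} {Θ : M → V} {G : V → N} (hΘ : MDifferentiableAt I 𝓘(ℝ, V) Θ p)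
    (hΘS : ∀ q, Θ q ∈ S) (hG : MDifferentiableWithinAt 𝓘(ℝ, V) I' G S (Θ p))
    (hiG : i =ᶠ[𝓝 p] G ∘ Θ) : Function.Injective (mfderiv I 𝓘(ℝ, V) Θ p) := by
  have h1 := HasMFDerivWithinAt.comp p hG.hasMFDerivWithinAt
    (hΘ.hasMFDerivAt.hasMFDerivWithinAt (s := univ)) (fun q _ => hΘS q)
  rw [hasMFDerivWithinAt_univ] at h1
  have h2 := (h1.congr_of_eventuallyEq hiG).mfderiv
  have h3 : Function.Injective (mfderivWithin 𝓘(ℝ, V) I' G S (Θ p) ∘ mfderiv I 𝓘(ℝ, V) Θ p) := by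
    intro a c hac
    apply hi
    rw [h2]
    exact hac
  exact h3.of_comp

end ManifoldScalar

/-! ### Submanifolds of Euclidean spaces -/

section Submanifold

open Filter Topology Set

variable {Z : Type*} [NormedAddCommGroup Z] [InnerProductSpace ℝ Z]
  [FiniteDimensional ℝ Z] {Y : Type*} [NormedAddCommGroup Y] [NormedSpace ℝ Y]
  [FiniteDimensional ℝ Y]
  {X : Set Z} [ChartedSpace Y X] [IsManifold 𝓘(ℝ, Y) ∞ X]

/-- The local parametrization of a submanifold around `q`. -/
def localParam (q : X) : Y → Z := Subtype.val ∘ (extChartAt 𝓘(ℝ, Y) q).symm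

lemma contDiffAt_localParam
    (hX : IsSmoothImmersion 𝓘(ℝ, Y) 𝓘(ℝ, Z) (Subtype.val : X → Z)) (q : X) :
    ContDiffAt ℝ ∞ (localParam q : Y → Z) (extChartAt 𝓘(ℝ, Y) q q) := by
  have := (hX.contMDiff q).contDiffWithinAt_chart
  rwa [ModelWithCorners.range_eq_univ, contDiffWithinAt_univ] at this

lemma injective_fderiv_localParam
    (hX : IsSmoothImmersion 𝓘(ℝ, Y) 𝓘(ℝ, Z) (Subtype.val : X → Z)) (q : X) :
    Function.Injective (fderiv ℝ (localParam q : Y → Z) (extChartAt 𝓘(ℝ, Y) q q)) := by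
  have h1 := ((hX.contMDiff q).mdifferentiableAt (by decide)).mfderiv_eq_chart
  rw [ModelWithCorners.range_eq_univ, fderivWithin_univ] at h1
  have h2 := hX.injective_mfderiv q
  rw [h1] at h2
  exact h2

/-- The scalar curvature of the submanifold at `q` is the Gauss expression of its
parametrization. -/
lemma jetScal_localParam_pos
    (hX : IsSmoothImmersion 𝓘(ℝ, Y) 𝓘(ℝ, Z) (Subtype.val : X → Z))
    (hscal : HasPositiveInducedScal 𝓘(ℝ, Y) (Subtype.val : X → Z)) (q : X) :
    0 < jetScal (Module.finBasis ℝ Y)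
      (fderiv ℝ (localParam q : Y → Z) (extChartAt 𝓘(ℝ, Y) q q))
      (fderiv ℝ (fderiv ℝ (localParam q : Y → Z)) (extChartAt 𝓘(ℝ, Y) q q)) := by
  have h1 := hscal q
  rw [scalarCurvature_inducedMetric hX.contMDiff (hX.injective_mfderiv q)] at h1
  simp only [ModelWithCorners.range_eq_univ, fderivWithin_univ] at h1
  exact h1

/-- A chart of a submanifold extends locally to a smooth map of the ambient space, by the inverse
function theorem. -/
lemma exists_chart_extension
    (hX : IsSmoothImmersion 𝓘(ℝ, Y) 𝓘(ℝ, Z) (Subtype.val : X → Z)) (q : X) :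
    ∃ ρ : Z → Y, ContDiffAt ℝ ∞ ρ q ∧ ∀ᶠ r : X in 𝓝 q, ρ r = extChartAt 𝓘(ℝ, Y) q r := by
  set y₀ := extChartAt 𝓘(ℝ, Y) q q
  have hφ := contDiffAt_localParam (Y := Y) hX q
  have hinj := injective_fderiv_localParam (Y := Y) hX q
  have hφy : localParam q y₀ = (q : Z) := congrArg Subtype.val (extChartAt_to_inv (I := 𝓘(ℝ, Y)) q)
  obtain ⟨g, hg⟩ := LinearMap.exists_leftInverse_of_injective
    (fderiv ℝ (localParam q : Y → Z) y₀).toLinearMap (LinearMap.ker_eq_bot.2 hinj)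
  let Λ : Z →L[ℝ] Y := LinearMap.toContinuousLinearMap g
  let h : Y → Y := Λ ∘ localParam q
  have hh : ContDiffAt ℝ ∞ h y₀ := Λ.contDiff.contDiffAt.comp y₀ hφ
  have hh' : HasFDerivAt h ((ContinuousLinearEquiv.refl ℝ Y : Y ≃L[ℝ] Y) : Y →L[ℝ] Y) y₀ := by
    have h1 : HasFDerivAt h (Λ.comp (fderiv ℝ (localParam q : Y → Z) y₀)) y₀ :=
      Λ.hasFDerivAt.comp y₀ (hφ.differentiableAt (by decide)).hasFDerivAt
    convert h1 using 1
    ext v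
    exact (congrArg (fun T : Y →ₗ[ℝ] Y => T v) hg).symm
  have hn : (∞ : ℕ∞ω) ≠ 0 := by decide
  have hstrict := hh.hasStrictFDerivAt' hh' hn
  refine ⟨hh.localInverse hh' hn ∘ Λ, ?_, ?_⟩
  · refine ContDiffAt.comp (q : Z) ?_ Λ.contDiff.contDiffAt
    have h1 := hh.to_localInverse hh' hn
    have h2 : h y₀ = Λ q := by simp [h, hφy]
    rwa [h2] at h1
  · have h1 : ∀ᶠ y in 𝓝 y₀, hh.localInverse hh' hn (h y) = y := hstrict.eventually_left_inverse
    have h2 : Tendsto (extChartAt 𝓘(ℝ, Y) q) (𝓝 q) (𝓝 y₀) := (continuousAt_extChartAt q).tendsto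
    filter_upwards [h2.eventually h1, extChartAt_source_mem_nhds (I := 𝓘(ℝ, Y)) q] with r hr hrs
    have h3 : localParam q (extChartAt 𝓘(ℝ, Y) q r) = (r : Z) :=
      congrArg Subtype.val ((extChartAt 𝓘(ℝ, Y) q).left_inv hrs)
    simp only [h, Function.comp_apply, h3] at hr
    exact hr

end Submanifold

/-! ### Orthogonal trivializations in coordinates -/

section TrivializationCoordinates

open Filter Topology Set

variable {𝓑 : Type*} [NormedAddCommGroup 𝓑] [NormedSpace ℝ 𝓑] [FiniteDimensional ℝ 𝓑]
  {H : Type*} [TopologicalSpace H] {I : ModelWithCorners ℝ 𝓑 H}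
  {B : Type*} [TopologicalSpace B] [ChartedSpace H B] [IsManifold I ∞ B]
  {Z : Type*} [NormedAddCommGroup Z] [InnerProductSpace ℝ Z] [FiniteDimensional ℝ Z]
  {E : B → Type*} [TopologicalSpace (TotalSpace Z E)]
  [∀ x, NormedAddCommGroup (E x)] [∀ x, InnerProductSpace ℝ (E x)]
  [FiberBundle Z E] [VectorBundle ℝ Z E]
  {W : Type*} [NormedAddCommGroup W] [InnerProductSpace ℝ W] [FiniteDimensional ℝ W]

lemma ContDiffWithinAt.clm_of_apply {V : Type*} [NormedAddCommGroup V] [NormedSpace ℝ V]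
    {N : V → Z →L[ℝ] W} {s : Set V} {x : V} {n : ℕ∞ω}
    (h : ∀ z, ContDiffWithinAt ℝ n (fun y => N y z) s x) : ContDiffWithinAt ℝ n N s x := by
  set e := stdOrthonormalBasis ℝ Z
  have h1 : N = fun y => ∑ i, (innerSL ℝ (e i)).smulRight (N y (e i)) := by
    ext y z
    conv_lhs => rw [← e.sum_repr' z, map_sum]
    simp
  rw [h1]
  exact ContDiffWithinAt.sum fun i _ =>
    contDiffWithinAt_const.smulRight (h (e i))

/-- The coordinate parametrization of the total space of a bundle by a chart of the base and a
trivialization. -/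
def bundleParam (I : ModelWithCorners ℝ 𝓑 H) (e : Trivialization Z (π Z E)) (x₀ : B) (p : 𝓑 × Z) :
    TotalSpace Z E :=
  e.toOpenPartialHomeomorph.symm ((extChartAt I x₀).symm p.1, p.2)

/-- The coordinates of the points over the domain of both the chart of the base at `x₀` and the
trivialization `e`. -/
def coordDomain (I : ModelWithCorners ℝ 𝓑 H) (e : Trivialization Z (π Z E)) (x₀ : B) : Set 𝓑 :=
  (extChartAt I x₀).target ∩ (extChartAt I x₀).symm ⁻¹' e.baseSet

variable {e : Trivialization Z (π Z E)} {x₀ : B}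

lemma coordDomain_subset_range : coordDomain I e x₀ ⊆ range I :=
  fun _ h => extChartAt_target_subset_range x₀ h.1

lemma coordDomain_mem_nhdsWithin {x : 𝓑} (hx : x ∈ coordDomain I e x₀) :
    coordDomain I e x₀ ∈ 𝓝[range I] x :=
  inter_mem (extChartAt_target_mem_nhdsWithin_of_mem hx.1)
    (mem_nhdsWithin_of_mem_nhds ((continuousAt_extChartAt_symm'' hx.1).preimage_mem_nhds
      (e.open_baseSet.mem_nhds hx.2)))

lemma extChartAt_mem_coordDomain {x : B} (hx : x ∈ (extChartAt I x₀).source) (hxe : x ∈ e.baseSet) :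
    extChartAt I x₀ x ∈ coordDomain I e x₀ :=
  ⟨(extChartAt I x₀).map_source hx, by rwa [mem_preimage, (extChartAt I x₀).left_inv hx]⟩

lemma bundleParam_proj {x : 𝓑} (hx : x ∈ coordDomain I e x₀) (z : Z) :
    (bundleParam I e x₀ (x, z)).proj = (extChartAt I x₀).symm x :=
  e.proj_symm_apply (e.mem_target.2 hx.2)

lemma bundleParam_mem_source {x : 𝓑} (hx : x ∈ coordDomain I e x₀) (z : Z) :
    bundleParam I e x₀ (x, z) ∈ e.source :=
  e.mem_source.2 (by rw [bundleParam_proj hx]; exact hx.2)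

lemma apply_bundleParam {x : 𝓑} (hx : x ∈ coordDomain I e x₀) (z : Z) :
    e (bundleParam I e x₀ (x, z)) = ((extChartAt I x₀).symm x, z) :=
  e.apply_symm_apply (e.mem_target.2 hx.2)

lemma contMDiffWithinAt_bundleParam (he : IsOrthogonalTrivialization I e) {x : 𝓑}
    (hx : x ∈ coordDomain I e x₀) (z : Z) :
    ContMDiffWithinAt 𝓘(ℝ, 𝓑 × Z) (I.prod 𝓘(ℝ, Z)) ∞ (bundleParam I e x₀) (range I ×ˢ univ)
      (x, z) := by
  have h1 : ContMDiffAt (I.prod 𝓘(ℝ, Z)) (I.prod 𝓘(ℝ, Z)) ∞ e.toOpenPartialHomeomorph.symm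
      ((extChartAt I x₀).symm x, z) :=
    he.contMDiffOn_symm.contMDiffAt (e.open_target.mem_nhds (e.mem_target.2 hx.2))
  have h2 : ContMDiffWithinAt 𝓘(ℝ, 𝓑 × Z) I ∞ (fun p : 𝓑 × Z => (extChartAt I x₀).symm p.1)
      (range I ×ˢ univ) (x, z) :=
    (contMDiffWithinAt_extChartAt_symm_range x₀ hx.1).comp (t := range I) (x, z)
      contDiffWithinAt_fst.contMDiffWithinAt fun p hp => hp.1
  have h3 : ContMDiffWithinAt 𝓘(ℝ, 𝓑 × Z) 𝓘(ℝ, Z) ∞ (fun p : 𝓑 × Z => p.2)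
      (range I ×ˢ univ) (x, z) := contDiffWithinAt_snd.contMDiffWithinAt
  exact h1.comp_contMDiffWithinAt (x, z) (h2.prodMk h3)

lemma contMDiffAt_trivialization_snd (he : IsOrthogonalTrivialization I e) {w : TotalSpace Z E}
    (hw : w ∈ e.source) : ContMDiffAt (I.prod 𝓘(ℝ, Z)) 𝓘(ℝ, Z) ∞ (fun w => (e w).2) w :=
  contMDiffAt_snd.comp w (he.contMDiffOn.contMDiffAt (e.open_source.mem_nhds hw))

lemma contMDiffAt_chart_proj {w : TotalSpace Z E} (hw : w.proj ∈ (extChartAt I x₀).source) :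
    ContMDiffAt (I.prod 𝓘(ℝ, Z)) 𝓘(ℝ, 𝓑) ∞ (fun w : TotalSpace Z E => extChartAt I x₀ w.proj) w :=
  (contMDiffAt_extChartAt' (by rwa [extChartAt_source] at hw)).comp w (contMDiff_proj E w)

lemma uniqueDiffOn_range_prod : UniqueDiffOn ℝ (range I ×ˢ (univ : Set Z)) :=
  I.uniqueDiffOn.prod uniqueDiffOn_univ

lemma injective_mfderivWithin_bundleParam (he : IsOrthogonalTrivialization I e) {x : 𝓑}
    (hx : x ∈ coordDomain I e x₀) (z : Z) :
    Function.Injective (mfderivWithin 𝓘(ℝ, 𝓑 × Z) (I.prod 𝓘(ℝ, Z)) (bundleParam I e x₀)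
      (range I ×ˢ univ) (x, z)) := by
  have hmem : ((x, z) : 𝓑 × Z) ∈ range I ×ˢ (univ : Set Z) := ⟨coordDomain_subset_range hx, trivial⟩
  have hs : (bundleParam I e x₀ (x, z)).proj ∈ (extChartAt I x₀).source := by
    rw [bundleParam_proj hx]; exact (extChartAt I x₀).map_target hx.1
  have h1 : MDifferentiableAt (I.prod 𝓘(ℝ, Z)) 𝓘(ℝ, 𝓑 × Z)
      (fun w : TotalSpace Z E => (extChartAt I x₀ w.proj, (e w).2)) (bundleParam I e x₀ (x, z)) :=
    ((contMDiffAt_chart_proj hs).prodMk_space (contMDiffAt_trivialization_snd he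
      (bundleParam_mem_source hx z))).mdifferentiableAt (by decide)
  have h2 := (contMDiffWithinAt_bundleParam he hx z).mdifferentiableWithinAt (by decide)
  have h3 := h1.hasMFDerivAt.comp_hasMFDerivWithinAt (x, z) h2.hasMFDerivWithinAt
  have hid : (id : 𝓑 × Z → 𝓑 × Z) =ᶠ[𝓝[range I ×ˢ univ] (x, z)]
      (fun w : TotalSpace Z E => (extChartAt I x₀ w.proj, (e w).2)) ∘ bundleParam I e x₀ := by
    have h4 : ∀ᶠ p : 𝓑 × Z in 𝓝[range I ×ˢ univ] (x, z), p.1 ∈ coordDomain I e x₀ := by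
      rw [nhdsWithin_prod_eq]
      exact tendsto_fst.eventually (coordDomain_mem_nhdsWithin hx)
    filter_upwards [h4] with p hp
    obtain ⟨y, z'⟩ := p
    simp only [Function.comp_apply, id, bundleParam_proj hp, apply_bundleParam hp,
      (extChartAt I x₀).right_inv hp.1]
  have h5 := (h3.congr_of_eventuallyEq hid (hid.self_of_nhdsWithin hmem)).mfderivWithin
    (uniqueDiffOn_range_prod.uniqueMDiffOn _ hmem)
  rw [mfderivWithin_id (uniqueDiffOn_range_prod.uniqueMDiffOn _ hmem)] at h5
  intro a c hac
  have h6 := congrArg (fun T : (𝓑 × Z) →L[ℝ] (𝓑 × Z) => T a) h5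
  have h7 := congrArg (fun T : (𝓑 × Z) →L[ℝ] (𝓑 × Z) => T c) h5
  refine h6.trans (Eq.trans ?_ h7.symm)
  exact congrArg (mfderiv (I.prod 𝓘(ℝ, Z)) 𝓘(ℝ, 𝓑 × Z)
      (fun w : TotalSpace Z E => (extChartAt I x₀ w.proj, (e w).2)) (bundleParam I e x₀ (x, z))) hac

variable {F : TotalSpace Z E → W}

lemma contDiffWithinAt_comp_bundleParam (he : IsOrthogonalTrivialization I e)
    (hF : IsSmoothImmersion (I.prod 𝓘(ℝ, Z)) 𝓘(ℝ, W) F) {x : 𝓑} (hx : x ∈ coordDomain I e x₀)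
    (z : Z) :
    ContDiffWithinAt ℝ ∞ (F ∘ bundleParam I e x₀) (range I ×ˢ univ) (x, z) :=
  ((hF.contMDiff _).comp_contMDiffWithinAt (x, z)
    (contMDiffWithinAt_bundleParam he hx z)).contDiffWithinAt

lemma injective_fderivWithin_comp_bundleParam (he : IsOrthogonalTrivialization I e)
    (hF : IsSmoothImmersion (I.prod 𝓘(ℝ, Z)) 𝓘(ℝ, W) F) {x : 𝓑} (hx : x ∈ coordDomain I e x₀)
    (z : Z) :
    Function.Injective (fderivWithin ℝ (F ∘ bundleParam I e x₀) (range I ×ˢ univ) (x, z)) := by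
  have hmem : ((x, z) : 𝓑 × Z) ∈ range I ×ˢ (univ : Set Z) := ⟨coordDomain_subset_range hx, trivial⟩
  rw [← mfderivWithin_eq_fderivWithin, mfderiv_comp_mfderivWithin (I' := I.prod 𝓘(ℝ, Z)) (x, z)
    ((hF.contMDiff _).mdifferentiableAt (by decide))
    ((contMDiffWithinAt_bundleParam he hx z).mdifferentiableWithinAt (by decide))
    (uniqueDiffOn_range_prod.uniqueMDiffOn _ hmem)]
  exact (hF.injective_mfderiv _).comp (injective_mfderivWithin_bundleParam he hx z)

/-! ### The normalized fibre coordinates -/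

/-- The derivative at `x` of the restriction of `F` to the zero section, on the standard basis. -/
def baseDeriv (I : ModelWithCorners ℝ 𝓑 H) (F : TotalSpace Z E → W) (x : B) :
    Fin (Module.finrank ℝ 𝓑) → W := fun i =>
  (mfderiv I 𝓘(ℝ, W) (F ∘ zeroSection Z E) x : 𝓑 →L[ℝ] W) (Module.finBasis ℝ 𝓑 i)

/-- The derivative of `F` along the fibre over `x` at the zero vector, where the fibre is identified
with the model fibre by `e`. -/
def fibreDeriv (F : TotalSpace Z E → W) (e : Trivialization Z (π Z E)) (x : B) : Z →L[ℝ] W :=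
  fderiv ℝ (fun z => F (e.toOpenPartialHomeomorph.symm (x, z))) 0

/-- The component of the fibre derivative of `F` orthogonal to the image of the zero section. -/
def normalFibreDeriv (I : ModelWithCorners ℝ 𝓑 H) (F : TotalSpace Z E → W)
    (e : Trivialization Z (π Z E)) (x : B) : Z →L[ℝ] W :=
  LinearMap.toContinuousLinearMap
    ((normalPartₗ (baseDeriv I F x)).comp (fibreDeriv F e x).toLinearMap)

lemma normalFibreDeriv_apply (x : B) (z : Z) :
    normalFibreDeriv I F e x z = normalPart (baseDeriv I F x) (fibreDeriv F e x z) := rfl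

lemma fibreDeriv_eq (he : IsOrthogonalTrivialization I e)
    (hF : IsSmoothImmersion (I.prod 𝓘(ℝ, Z)) 𝓘(ℝ, W) F) {x : 𝓑} (hx : x ∈ coordDomain I e x₀)
    (z : Z) :
    fibreDeriv F e ((extChartAt I x₀).symm x) z =
      fderivWithin ℝ (F ∘ bundleParam I e x₀) (range I ×ˢ univ) (x, 0) (0, z) := by
  have h1 := ((contDiffWithinAt_comp_bundleParam he hF hx 0).differentiableWithinAt
    (by decide)).hasFDerivWithinAt
  have h2 : HasFDerivWithinAt (fun z : Z => ((x, z) : 𝓑 × Z)) (ContinuousLinearMap.inr ℝ 𝓑 Z)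
      univ 0 := (hasFDerivAt_prodMk_right x (0 : Z)).hasFDerivWithinAt
  have h3 := h1.comp (0 : Z) h2 fun z _ => ⟨coordDomain_subset_range hx, trivial⟩
  rw [hasFDerivWithinAt_univ] at h3
  have h4 : fibreDeriv F e ((extChartAt I x₀).symm x) = _ := h3.fderiv
  rw [h4]
  rfl

lemma symm_zero (he : IsOrthogonalTrivialization I e) {x : B} (hx : x ∈ e.baseSet) :
    e.toOpenPartialHomeomorph.symm (x, 0) = zeroSection Z E x := by
  have := he.isLinear
  have h1 : (e (TotalSpace.mk' Z x 0)).2 = 0 := (e.linear ℝ hx).map_zero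
  have h2 := e.symm_apply_mk_proj (x := TotalSpace.mk' Z x (0 : E x)) (e.mem_source.2 hx)
  rw [h1] at h2
  exact h2

lemma hasFDerivWithinAt_comp_bundleParam_zero (he : IsOrthogonalTrivialization I e)
    (hF : IsSmoothImmersion (I.prod 𝓘(ℝ, Z)) 𝓘(ℝ, W) F) {x : 𝓑} (hx : x ∈ coordDomain I e x₀) :
    HasFDerivWithinAt (fun y => F (bundleParam I e x₀ (y, 0)))
      ((fderivWithin ℝ (F ∘ bundleParam I e x₀) (range I ×ˢ univ) (x, 0)).comp
        (ContinuousLinearMap.inl ℝ 𝓑 Z)) (range I) x := by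
  have h1 := ((contDiffWithinAt_comp_bundleParam he hF hx 0).differentiableWithinAt
    (by decide)).hasFDerivWithinAt
  exact h1.comp (g := F ∘ bundleParam I e x₀) (f := fun y : 𝓑 => (y, (0 : Z))) (s := range I)
    (t := range I ×ˢ (univ : Set Z)) x
    (hasFDerivAt_prodMk_left x (0 : Z)).hasFDerivWithinAt fun y hy => ⟨hy, trivial⟩

/-- In coordinates, the derivative of the restriction of `F` to the zero section is the derivative
in the base directions, up to an invertible linear map of the base directions. -/
lemma exists_mfderiv_zeroSection_eq (he : IsOrthogonalTrivialization I e)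
    (hF : IsSmoothImmersion (I.prod 𝓘(ℝ, Z)) 𝓘(ℝ, W) F) {x : 𝓑} (hx : x ∈ coordDomain I e x₀) :
    ∃ (A : 𝓑 →L[ℝ] W) (J : 𝓑 ≃L[ℝ] 𝓑),
      (∀ i, baseDeriv I F ((extChartAt I x₀).symm x) i = A (Module.finBasis ℝ 𝓑 i)) ∧
      ∀ v, A (J v) = fderivWithin ℝ (F ∘ bundleParam I e x₀) (range I ×ˢ univ) (x, 0) (v, 0) := by
  have : IsManifold I 1 B := IsManifold.of_le (n := ∞) (by decide)
  have hxI := coordDomain_subset_range hx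
  obtain ⟨J, hJ⟩ := isInvertible_mfderivWithin_extChartAt_symm (I := I) hx.1
  refine ⟨mfderiv I 𝓘(ℝ, W) (F ∘ zeroSection Z E) ((extChartAt I x₀).symm x), J, fun i => rfl,
    fun v => ?_⟩
  have h0 : MDifferentiableAt I 𝓘(ℝ, W) (F ∘ zeroSection Z E) ((extChartAt I x₀).symm x) :=
    ((hF.contMDiff _).comp _ (contMDiff_zeroSection ℝ E _)).mdifferentiableAt (by decide)
  have h1 := mfderiv_comp_mfderivWithin (I := 𝓘(ℝ, 𝓑)) (I' := I) (I'' := 𝓘(ℝ, W)) x h0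
    (mdifferentiableWithinAt_extChartAt_symm hx.1) (I.uniqueDiffOn.uniqueMDiffOn x hxI)
  have h2 : (F ∘ zeroSection Z E) ∘ (extChartAt I x₀).symm =ᶠ[𝓝[range I] x]
      fun y => F (bundleParam I e x₀ (y, 0)) := by
    filter_upwards [coordDomain_mem_nhdsWithin hx] with y hy
    simp only [Function.comp_apply, bundleParam, symm_zero he hy.2]
  rw [mfderivWithin_eq_fderivWithin, h2.fderivWithin_eq_of_mem hxI,
    (hasFDerivWithinAt_comp_bundleParam_zero he hF hx).fderivWithin (I.uniqueDiffOn x hxI),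
    ← hJ] at h1
  exact (congrArg (fun T : 𝓑 →L[ℝ] W => T v) h1).symm

lemma linearIndependent_and_span_eq_of_comp {A : 𝓑 →L[ℝ] W} {J : 𝓑 ≃L[ℝ] 𝓑}
    {D : 𝓑 × Z →L[ℝ] W} (hD : Function.Injective D) (hAJ : ∀ v, A (J v) = D (v, 0))
    {ι : Type*} [Fintype ι] [DecidableEq ι] (b : Module.Basis ι ℝ 𝓑) :
    LinearIndependent ℝ (fun i => A (b i)) ∧ LinearIndependent ℝ (fun i => D (b i, (0 : Z))) ∧
    Submodule.span ℝ (range fun i => A (b i)) =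
      Submodule.span ℝ (range fun i => D (b i, (0 : Z))) := by
  have hLinj : Function.Injective (D.comp (ContinuousLinearMap.inl ℝ 𝓑 Z)) := fun a c hac =>
    (Prod.ext_iff.1 (hD hac)).1
  have hAinj : Function.Injective A := by
    intro a c hac
    obtain ⟨a, rfl⟩ := J.surjective a
    obtain ⟨c, rfl⟩ := J.surjective c
    rw [hAJ, hAJ] at hac
    rw [hLinj hac]
  have hrange : LinearMap.range A.toLinearMap =
      LinearMap.range (D.comp (ContinuousLinearMap.inl ℝ 𝓑 Z)).toLinearMap := by
    ext w
    constructor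
    · rintro ⟨a, rfl⟩
      obtain ⟨a, rfl⟩ := J.surjective a
      exact ⟨a, (hAJ a).symm⟩
    · rintro ⟨a, rfl⟩
      exact ⟨J a, hAJ a⟩
  exact ⟨linearIndependent_of_injective b hAinj, linearIndependent_of_injective b hLinj,
    (span_range_basis b A).trans (hrange.trans
      (span_range_basis b (D.comp (ContinuousLinearMap.inl ℝ 𝓑 Z))).symm)⟩

lemma baseDeriv_coord (he : IsOrthogonalTrivialization I e)
    (hF : IsSmoothImmersion (I.prod 𝓘(ℝ, Z)) 𝓘(ℝ, W) F) {x : 𝓑} (hx : x ∈ coordDomain I e x₀) :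
    LinearIndependent ℝ (baseDeriv I F ((extChartAt I x₀).symm x)) ∧
    LinearIndependent ℝ (fun i => fderivWithin ℝ (F ∘ bundleParam I e x₀) (range I ×ˢ univ) (x, 0)
      (Module.finBasis ℝ 𝓑 i, (0 : Z))) ∧
    Submodule.span ℝ (range (baseDeriv I F ((extChartAt I x₀).symm x))) =
      Submodule.span ℝ (range fun i => fderivWithin ℝ (F ∘ bundleParam I e x₀) (range I ×ˢ univ)
        (x, 0) (Module.finBasis ℝ 𝓑 i, (0 : Z))) := by
  obtain ⟨A, J, hA, hAJ⟩ := exists_mfderiv_zeroSection_eq he hF hx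
  have h := linearIndependent_and_span_eq_of_comp
    (injective_fderivWithin_comp_bundleParam he hF hx 0) hAJ (Module.finBasis ℝ 𝓑)
  rwa [← funext hA] at h

lemma normalFibreDeriv_coord (he : IsOrthogonalTrivialization I e)
    (hF : IsSmoothImmersion (I.prod 𝓘(ℝ, Z)) 𝓘(ℝ, W) F) {x : 𝓑} (hx : x ∈ coordDomain I e x₀)
    (z : Z) :
    normalFibreDeriv I F e ((extChartAt I x₀).symm x) z =
      normalPart (fun i => fderivWithin ℝ (F ∘ bundleParam I e x₀) (range I ×ˢ univ) (x, 0)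
        (Module.finBasis ℝ 𝓑 i, (0 : Z)))
        (fderivWithin ℝ (F ∘ bundleParam I e x₀) (range I ×ˢ univ) (x, 0) (0, z)) := by
  obtain ⟨h1, h2, h3⟩ := baseDeriv_coord he hF hx
  rw [normalFibreDeriv_apply, fibreDeriv_eq he hF hx,
    normalPart_congr_span (isUnit_det_gram h1) (isUnit_det_gram h2) h3]

lemma injective_normalFibreDeriv_coord (he : IsOrthogonalTrivialization I e)
    (hF : IsSmoothImmersion (I.prod 𝓘(ℝ, Z)) 𝓘(ℝ, W) F) {x : 𝓑} (hx : x ∈ coordDomain I e x₀) :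
    Function.Injective (normalFibreDeriv I F e ((extChartAt I x₀).symm x)) := by
  refine (injective_iff_map_eq_zero _).2 fun z hz => ?_
  set D := fderivWithin ℝ (F ∘ bundleParam I e x₀) (range I ×ˢ univ) (x, 0) with hD
  rw [normalFibreDeriv_coord he hF hx] at hz
  have h1 := sub_normalPart_mem (fun i => D (Module.finBasis ℝ 𝓑 i, (0 : Z))) (D (0, z))
  rw [hz, sub_zero] at h1
  have h2 := span_range_basis (Module.finBasis ℝ 𝓑) (D.comp (ContinuousLinearMap.inl ℝ 𝓑 Z))
  have h3 : D (0, z) ∈ LinearMap.range (D.comp (ContinuousLinearMap.inl ℝ 𝓑 Z)).toLinearMap := by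
    rw [← h2]; exact h1
  obtain ⟨a, ha⟩ := h3
  have h4 : ((a, 0) : 𝓑 × Z) = (0, z) := injective_fderivWithin_comp_bundleParam he hF hx 0 ha
  exact (Prod.ext_iff.1 h4).2.symm

lemma injective_normalFibreDeriv (he : IsOrthogonalTrivialization I e)
    (hF : IsSmoothImmersion (I.prod 𝓘(ℝ, Z)) 𝓘(ℝ, W) F) {x : B} (hx : x ∈ e.baseSet) :
    Function.Injective (normalFibreDeriv I F e x) := by
  have h := injective_normalFibreDeriv_coord (x₀ := x) he hF
    (extChartAt_mem_coordDomain (mem_extChartAt_source x) hx)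
  rwa [extChartAt_to_inv] at h

lemma ContDiffWithinAt.normalPart {V : Type*} [NormedAddCommGroup V] [NormedSpace ℝ V]
    {ι : Type*} [Fintype ι] [DecidableEq ι] {d : V → ι → W} {w : V → W} {s : Set V} {x : V}
    {n : ℕ∞ω} (hd : ∀ i, ContDiffWithinAt ℝ n (fun y => d y i) s x)
    (hw : ContDiffWithinAt ℝ n w s x) (hx : LinearIndependent ℝ (d x)) :
    ContDiffWithinAt ℝ n (fun y => normalPart (d y) (w y)) s x :=
  hw.sub (ContDiffWithinAt.sum fun k _ => (ContDiffWithinAt.sum fun l _ =>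
    (ContDiffWithinAt.matrix_inv (A := fun y => Matrix.gram ℝ (d y))
      (fun i j => (hd i).inner ℝ (hd j)) (isUnit_det_gram hx) k l).mul
      (hw.inner ℝ (hd l))).smul (hd k))

lemma contDiffWithinAt_normalFibreDeriv (he : IsOrthogonalTrivialization I e)
    (hF : IsSmoothImmersion (I.prod 𝓘(ℝ, Z)) 𝓘(ℝ, W) F) {x : 𝓑} (hx : x ∈ coordDomain I e x₀) :
    ContDiffWithinAt ℝ ∞ (fun y => normalFibreDeriv I F e ((extChartAt I x₀).symm y)) (range I)
      x := by
  have hxI := coordDomain_subset_range hx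
  have hD : ContDiffWithinAt ℝ ∞
      (fun y : 𝓑 => fderivWithin ℝ (F ∘ bundleParam I e x₀) (range I ×ˢ univ) (y, (0 : Z)))
      (range I) x := by
    have h1 := (contDiffWithinAt_comp_bundleParam he hF hx 0).fderivWithin_right (m := ∞)
      uniqueDiffOn_range_prod (by decide) ⟨hxI, trivial⟩
    exact h1.comp (s := range I) (t := range I ×ˢ (univ : Set Z)) (f := fun y : 𝓑 => (y, (0 : Z))) x
      (contDiffWithinAt_id.prodMk contDiffWithinAt_const) fun y hy => ⟨hy, trivial⟩
  refine ContDiffWithinAt.clm_of_apply fun z => ?_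
  have h2 := ContDiffWithinAt.normalPart (d := fun y i =>
      fderivWithin ℝ (F ∘ bundleParam I e x₀) (range I ×ˢ univ) (y, 0)
        (Module.finBasis ℝ 𝓑 i, (0 : Z)))
    (fun i => hD.clm_apply contDiffWithinAt_const)
    (hD.clm_apply (contDiffWithinAt_const (c := ((0, z) : 𝓑 × Z)))) (baseDeriv_coord he hF hx).2.1
  refine h2.congr_of_eventuallyEq_of_mem ?_ hxI
  filter_upwards [coordDomain_mem_nhdsWithin hx] with y hy
  exact normalFibreDeriv_coord he hF hy z

/-- The operator on the model fibre that makes the orthogonal component of the fibre derivative of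
`F` over `x` isometric. -/
def fibreNormalizer (I : ModelWithCorners ℝ 𝓑 H) (F : TotalSpace Z E → W)
    (e : Trivialization Z (π Z E)) (x : B) : Z →L[ℝ] Z :=
  normalizer (normalFibreDeriv I F e x)

lemma contDiffWithinAt_fibreNormalizer (he : IsOrthogonalTrivialization I e)
    (hF : IsSmoothImmersion (I.prod 𝓘(ℝ, Z)) 𝓘(ℝ, W) F) {x : 𝓑} (hx : x ∈ coordDomain I e x₀) :
    ContDiffWithinAt ℝ ∞ (fun y => fibreNormalizer I F e ((extChartAt I x₀).symm y)) (range I) x :=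
  (contDiffWithinAt_normalFibreDeriv he hF hx).normalizer (coordDomain_subset_range hx)
    (injective_normalFibreDeriv_coord he hF hx) (by decide)

/-- The immersion `F` in coordinates, with normalized fibre coordinates. -/
def normalizedParam (I : ModelWithCorners ℝ 𝓑 H) (F : TotalSpace Z E → W)
    (e : Trivialization Z (π Z E)) (x₀ : B) (p : 𝓑 × Z) : W :=
  F (bundleParam I e x₀ (p.1, fibreNormalizer I F e ((extChartAt I x₀).symm p.1) p.2))

lemma contDiffWithinAt_normalizing (he : IsOrthogonalTrivialization I e)
    (hF : IsSmoothImmersion (I.prod 𝓘(ℝ, Z)) 𝓘(ℝ, W) F) {x : 𝓑} (hx : x ∈ coordDomain I e x₀)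
    (z : Z) : ContDiffWithinAt ℝ ∞
      (fun p : 𝓑 × Z => fibreNormalizer I F e ((extChartAt I x₀).symm p.1) p.2)
      (range I ×ˢ univ) (x, z) := by
  have h1 : ContDiffWithinAt ℝ ∞
      (fun p : 𝓑 × Z => fibreNormalizer I F e ((extChartAt I x₀).symm p.1))
      (range I ×ˢ univ) (x, z) :=
    (contDiffWithinAt_fibreNormalizer he hF hx).comp (t := range I) (x, z) contDiffWithinAt_fst
      fun p hp => hp.1
  exact h1.clm_apply contDiffWithinAt_snd

lemma contDiffWithinAt_normalizedParam (he : IsOrthogonalTrivialization I e)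
    (hF : IsSmoothImmersion (I.prod 𝓘(ℝ, Z)) 𝓘(ℝ, W) F) {x : 𝓑} (hx : x ∈ coordDomain I e x₀)
    (z : Z) : ContDiffWithinAt ℝ ∞ (normalizedParam I F e x₀) (range I ×ˢ univ) (x, z) :=
  (contDiffWithinAt_comp_bundleParam he hF hx _).comp (g := F ∘ bundleParam I e x₀)
    (f := fun p : 𝓑 × Z => (p.1, fibreNormalizer I F e ((extChartAt I x₀).symm p.1) p.2))
    (s := range I ×ˢ univ) (t := range I ×ˢ (univ : Set Z)) (x, z)
    (contDiffWithinAt_fst.prodMk (contDiffWithinAt_normalizing he hF hx z))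
    fun _ hp => ⟨hp.1, trivial⟩

lemma fderivWithin_normalizedParam (he : IsOrthogonalTrivialization I e)
    (hF : IsSmoothImmersion (I.prod 𝓘(ℝ, Z)) 𝓘(ℝ, W) F) {x : 𝓑} (hx : x ∈ coordDomain I e x₀)
    (a : 𝓑) (z : Z) :
    fderivWithin ℝ (normalizedParam I F e x₀) (range I ×ˢ univ) (x, 0) (a, z) =
      fderivWithin ℝ (F ∘ bundleParam I e x₀) (range I ×ˢ univ) (x, 0)
        (a, fibreNormalizer I F e ((extChartAt I x₀).symm x) z) := by
  have hmem : ((x, 0) : 𝓑 × Z) ∈ range I ×ˢ (univ : Set Z) := ⟨coordDomain_subset_range hx, trivial⟩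
  have h1 : DifferentiableWithinAt ℝ
      (fun p : 𝓑 × Z => fibreNormalizer I F e ((extChartAt I x₀).symm p.1))
      (range I ×ˢ univ) (x, 0) :=
    ((contDiffWithinAt_fibreNormalizer he hF hx).comp (t := range I) ((x, 0) : 𝓑 × Z)
      contDiffWithinAt_fst fun p hp => hp.1).differentiableWithinAt (by decide)
  have h2 : HasFDerivWithinAt (fun p : 𝓑 × Z => p.2) (ContinuousLinearMap.snd ℝ 𝓑 Z)
    (range I ×ˢ univ) (x, 0) := hasFDerivAt_snd.hasFDerivWithinAt
  have h3 := h1.hasFDerivWithinAt.clm_apply h2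
  have h4 : HasFDerivWithinAt (fun p : 𝓑 × Z => p.1) (ContinuousLinearMap.fst ℝ 𝓑 Z)
    (range I ×ˢ univ) (x, 0) := hasFDerivAt_fst.hasFDerivWithinAt
  have h5 := h4.prodMk h3
  have h6 : HasFDerivWithinAt (F ∘ bundleParam I e x₀)
      (fderivWithin ℝ (F ∘ bundleParam I e x₀) (range I ×ˢ univ) (x, 0)) (range I ×ˢ univ)
      (x, fibreNormalizer I F e ((extChartAt I x₀).symm x) 0) := by
    rw [map_zero]
    exact ((contDiffWithinAt_comp_bundleParam he hF hx 0).differentiableWithinAt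
      (by decide)).hasFDerivWithinAt
  have h7 := h6.comp (s := range I ×ˢ univ) (t := range I ×ˢ (univ : Set Z)) ((x, 0) : 𝓑 × Z) h5
    fun p hp => ⟨hp.1, trivial⟩
  have h8 : fderivWithin ℝ (normalizedParam I F e x₀) (range I ×ˢ univ) (x, 0) = _ :=
    h7.fderivWithin (uniqueDiffOn_range_prod _ hmem)
  rw [h8]
  simp

/-- In normalized coordinates, the component of the fibre derivative orthogonal to the base
directions is isometric along the zero section. -/
lemma isometry_normalizedParam (he : IsOrthogonalTrivialization I e)
    (hF : IsSmoothImmersion (I.prod 𝓘(ℝ, Z)) 𝓘(ℝ, W) F) {x : 𝓑} (hx : x ∈ coordDomain I e x₀)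
    (z z' : Z) :
    inner ℝ
      (normalPart (fun i => fderivWithin ℝ (normalizedParam I F e x₀) (range I ×ˢ univ) (x, 0)
        (Module.finBasis ℝ 𝓑 i, (0 : Z)))
        (fderivWithin ℝ (normalizedParam I F e x₀) (range I ×ˢ univ) (x, 0) ((0 : 𝓑), z)))
      (normalPart (fun i => fderivWithin ℝ (normalizedParam I F e x₀) (range I ×ˢ univ) (x, 0)
        (Module.finBasis ℝ 𝓑 i, (0 : Z)))
        (fderivWithin ℝ (normalizedParam I F e x₀) (range I ×ˢ univ) (x, 0) ((0 : 𝓑), z'))) =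
      inner ℝ z z' := by
  simp only [fderivWithin_normalizedParam he hF hx, map_zero]
  rw [← normalFibreDeriv_coord he hF hx, ← normalFibreDeriv_coord he hF hx]
  exact (isNormalizer_normalizer (injective_normalFibreDeriv_coord he hF hx)).isometry z z'

/-! ### Independence of the trivialization -/

/-- The point `ε • A v` of the fibre of `v`, where `A` is the normalizing operator: the fibre of the
point is identified with the model fibre by `e`. -/
def scaledPoint (I : ModelWithCorners ℝ 𝓑 H) (F : TotalSpace Z E → W) (ε : ℝ)
    (e : Trivialization Z (π Z E)) (v : TotalSpace Z E) : TotalSpace Z E :=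
  e.toOpenPartialHomeomorph.symm (v.proj, fibreNormalizer I F e v.proj (ε • (e v).2))

/-- An orthogonal trivialization on a fibre, as a linear isometry. -/
def IsOrthogonalTrivialization.isometryAt (he : IsOrthogonalTrivialization I e) {x : B}
    (hx : x ∈ e.baseSet) : E x ≃ₗᵢ[ℝ] Z :=
  haveI := he.isLinear
  (e.linearEquivAt ℝ x hx).isometryOfInner fun v w => he.inner_eq x hx v w

lemma IsOrthogonalTrivialization.isometryAt_apply (he : IsOrthogonalTrivialization I e) {x : B}
    (hx : x ∈ e.baseSet) (v : E x) : he.isometryAt hx v = (e (TotalSpace.mk' Z x v)).2 := rfl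

lemma IsOrthogonalTrivialization.symm_eq (he : IsOrthogonalTrivialization I e) {x : B}
    (hx : x ∈ e.baseSet) (z : Z) :
    e.toOpenPartialHomeomorph.symm (x, z) = TotalSpace.mk' Z x ((he.isometryAt hx).symm z) := by
  have h1 := e.symm_apply_mk_proj (x := TotalSpace.mk' Z x ((he.isometryAt hx).symm z))
    (e.mem_source.2 hx)
  rw [← he.isometryAt_apply hx, LinearIsometryEquiv.apply_symm_apply] at h1
  exact h1

/-- Two orthogonal trivializations differ on a fibre by an isometry, under which the normalizing
operator is equivariant. Hence the scaled point does not depend on the trivialization. -/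
theorem scaledPoint_congr {e' : Trivialization Z (π Z E)} (he : IsOrthogonalTrivialization I e)
    (he' : IsOrthogonalTrivialization I e')
    (hF : IsSmoothImmersion (I.prod 𝓘(ℝ, Z)) 𝓘(ℝ, W) F) (ε : ℝ) {v : TotalSpace Z E}
    (hv : v.proj ∈ e.baseSet) (hv' : v.proj ∈ e'.baseSet) :
    scaledPoint I F ε e v = scaledPoint I F ε e' v := by
  obtain ⟨x, v⟩ := v
  change x ∈ e.baseSet at hv
  change x ∈ e'.baseSet at hv'
  set T : Z ≃ₗᵢ[ℝ] Z := (he.isometryAt hv).symm.trans (he'.isometryAt hv') with hT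
  have hsymm : ∀ z, e.toOpenPartialHomeomorph.symm (x, z) =
      e'.toOpenPartialHomeomorph.symm (x, T z) := by
    intro z
    rw [he.symm_eq hv, he'.symm_eq hv']
    simp [hT]
  have hTe : T (e ⟨x, v⟩).2 = (e' ⟨x, v⟩).2 := by
    have h1 : (e ⟨x, v⟩).2 = he.isometryAt hv v := rfl
    rw [h1, hT]
    simp only [LinearIsometryEquiv.trans_apply, LinearIsometryEquiv.symm_apply_apply]
    rfl
  have hN : ∀ z, normalFibreDeriv I F e x z = normalFibreDeriv I F e' x (T z) := by
    intro z
    rw [normalFibreDeriv_apply, normalFibreDeriv_apply]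
    congr 1
    have h1 : (fun z => F (e.toOpenPartialHomeomorph.symm (x, z))) =
        (fun z => F (e'.toOpenPartialHomeomorph.symm (x, z))) ∘ T.toContinuousLinearEquiv := by
      ext z
      exact congrArg F (hsymm z)
    have h2 := T.toContinuousLinearEquiv.comp_right_fderiv
      (f := fun z => F (e'.toOpenPartialHomeomorph.symm (x, z))) (x := (0 : Z))
    rw [← h1, map_zero] at h2
    exact congrArg (fun S : Z →L[ℝ] W => S z) h2
  have h3 := normalizer_comp_isometry (injective_normalFibreDeriv he' hF hv') T hN
  simp only [scaledPoint]
  rw [hsymm, ← hTe, ← map_smul, fibreNormalizer, h3]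
  rfl

end TrivializationCoordinates

/-! ### The scaled immersion of the sub-fibre bundle -/

section ScaledImmersion

open Filter Topology Set

variable {𝓑 : Type*} [NormedAddCommGroup 𝓑] [NormedSpace ℝ 𝓑] [FiniteDimensional ℝ 𝓑]
  {H : Type*} [TopologicalSpace H] {I : ModelWithCorners ℝ 𝓑 H}
  {B : Type*} [TopologicalSpace B] [ChartedSpace H B] [IsManifold I ∞ B]
  {Z : Type*} [NormedAddCommGroup Z] [InnerProductSpace ℝ Z] [FiniteDimensional ℝ Z]
  {E : B → Type*} [TopologicalSpace (TotalSpace Z E)]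
  [∀ x, NormedAddCommGroup (E x)] [∀ x, InnerProductSpace ℝ (E x)]
  [FiberBundle Z E] [VectorBundle ℝ Z E]
  {W : Type*} [NormedAddCommGroup W] [InnerProductSpace ℝ W] [FiniteDimensional ℝ W]
  {F : TotalSpace Z E → W}

/-- The composition of `F` with the normalization and the scaling by `ε` of the fibres; the operator
over `x` is computed in the trivialization `t x`. -/
def scaledMap (I : ModelWithCorners ℝ 𝓑 H) (F : TotalSpace Z E → W)
    (t : B → Trivialization Z (π Z E)) (ε : ℝ) (w : TotalSpace Z E) : W :=
  F (scaledPoint I F ε (t w.proj) w)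

/-- In every orthogonal trivialization, the scaled map is the normalized parametrization with scaled
fibre coordinates. -/
lemma scaledMap_eq {t : B → Trivialization Z (π Z E)} (ht : ∀ x, IsOrthogonalTrivialization I (t x))
    (hmem : ∀ x, x ∈ (t x).baseSet) {e : Trivialization Z (π Z E)}
    (he : IsOrthogonalTrivialization I e) (hF : IsSmoothImmersion (I.prod 𝓘(ℝ, Z)) 𝓘(ℝ, W) F)
    (ε : ℝ) {x₀ : B} {w : TotalSpace Z E} (hw : w.proj ∈ (extChartAt I x₀).source)
    (hwe : w.proj ∈ e.baseSet) :
    scaledMap I F t ε w = normalizedParam I F e x₀ (extChartAt I x₀ w.proj, ε • (e w).2) := by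
  rw [scaledMap, scaledPoint_congr (ht _) he hF ε (hmem _) hwe]
  simp only [normalizedParam, scaledPoint, bundleParam, (extChartAt I x₀).left_inv hw]

lemma eventually_proj_mem (w₀ : TotalSpace Z E) {e : Trivialization Z (π Z E)}
    (hmem : w₀.proj ∈ e.baseSet) :
    ∀ᶠ w : TotalSpace Z E in 𝓝 w₀,
      w.proj ∈ (extChartAt I w₀.proj).source ∧ w.proj ∈ e.baseSet := by
  have h1 : Tendsto (π Z E) (𝓝 w₀) (𝓝 w₀.proj) := (FiberBundle.continuous_proj Z E).continuousAt
  exact (h1.eventually (extChartAt_source_mem_nhds w₀.proj)).and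
    (h1.eventually (e.open_baseSet.mem_nhds hmem))

lemma contMDiff_scaledMap {t : B → Trivialization Z (π Z E)}
    (ht : ∀ x, IsOrthogonalTrivialization I (t x))
    (hmem : ∀ x, x ∈ (t x).baseSet) (hF : IsSmoothImmersion (I.prod 𝓘(ℝ, Z)) 𝓘(ℝ, W) F) (ε : ℝ) :
    ContMDiff (I.prod 𝓘(ℝ, Z)) 𝓘(ℝ, W) ∞ (scaledMap I F t ε) := by
  intro w₀
  set x₀ := w₀.proj
  have hs : w₀.proj ∈ (extChartAt I x₀).source := mem_extChartAt_source x₀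
  have h1 : scaledMap I F t ε =ᶠ[𝓝 w₀]
      normalizedParam I F (t x₀) x₀ ∘
        fun w => (extChartAt I x₀ w.proj, ε • ((t x₀) w).2) := by
    filter_upwards [eventually_proj_mem (I := I) w₀ (hmem x₀)] with w hw
    exact scaledMap_eq ht hmem (ht x₀) hF ε hw.1 hw.2
  refine ContMDiffAt.congr_of_eventuallyEq ?_ h1
  have h2 : ContMDiffAt (I.prod 𝓘(ℝ, Z)) 𝓘(ℝ, 𝓑 × Z) ∞
      (fun w : TotalSpace Z E => (extChartAt I x₀ w.proj, ε • ((t x₀) w).2)) w₀ :=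
    (contMDiffAt_chart_proj hs).prodMk_space
      ((contDiff_const_smul ε).contDiffAt.contMDiffAt.comp w₀
        (contMDiffAt_trivialization_snd (ht x₀) ((t x₀).mem_source.2 (hmem x₀))))
  have h3 := (contDiffWithinAt_normalizedParam (ht x₀) hF
    (extChartAt_mem_coordDomain hs (hmem x₀)) (ε • ((t x₀) w₀).2)).contMDiffWithinAt
  rw [← contMDiffWithinAt_univ] at h2 ⊢
  refine h3.comp w₀ h2 ?_
  exact fun w _ => ⟨mem_range_self _, trivial⟩

variable {Y : Type*} [NormedAddCommGroup Y] [NormedSpace ℝ Y] [FiniteDimensional ℝ Y]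
  {X : Set Z} [ChartedSpace Y X] [IsManifold 𝓘(ℝ, Y) ∞ X]
  {V : Set (TotalSpace Z E)} [ChartedSpace (ModelProd H Y) V] [IsManifold (I.prod 𝓘(ℝ, Y)) ∞ V]

/-- A trivialization that maps `V` onto a product with `X`, together with charts of the base and of
`X`, gives local coordinates of `V`. -/
lemma exists_subbundle_coordinates (hX : IsSmoothImmersion 𝓘(ℝ, Y) 𝓘(ℝ, Z) (Subtype.val : X → Z))
    (hV : IsSmoothImmersion (I.prod 𝓘(ℝ, Y)) (I.prod 𝓘(ℝ, Z)) (Subtype.val : V → TotalSpace Z E))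
    {e : Trivialization Z (π Z E)} (he : IsOrthogonalTrivialization I e)
    (heV : e '' (V ∩ e.source) = e.baseSet ×ˢ X) (v₀ : V) (hv₀ : v₀.1.proj ∈ e.baseSet) :
    ∃ (q₀ : X) (Θ : V → 𝓑 × Y), (∀ v, Θ v ∈ range I ×ˢ (univ : Set Y)) ∧
      Θ v₀ = (extChartAt I v₀.1.proj v₀.1.proj, extChartAt 𝓘(ℝ, Y) q₀ q₀) ∧
      ∀ᶠ v in 𝓝 v₀, ContMDiffAt (I.prod 𝓘(ℝ, Y)) 𝓘(ℝ, 𝓑 × Y) 2 Θ v ∧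
        Function.Injective (mfderiv (I.prod 𝓘(ℝ, Y)) 𝓘(ℝ, 𝓑 × Y) Θ v) ∧
        v.1.proj ∈ (extChartAt I v₀.1.proj).source ∧ v.1.proj ∈ e.baseSet ∧
        (Θ v).1 = extChartAt I v₀.1.proj v.1.proj ∧ localParam q₀ (Θ v).2 = (e v.1).2 := by
  have : IsManifold (I.prod 𝓘(ℝ, Y)) 2 V := IsManifold.of_le (n := ∞) (by decide)
  have hXmem : ∀ v : V, v.1.proj ∈ e.baseSet → (e v.1).2 ∈ X := fun v hv => by
    have h1 : e v.1 ∈ e.baseSet ×ˢ X := heV ▸ mem_image_of_mem e ⟨v.2, e.mem_source.2 hv⟩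
    exact h1.2
  set x₀ := v₀.1.proj with hx₀
  set q₀ : X := ⟨(e v₀.1).2, hXmem v₀ hv₀⟩ with hq₀
  obtain ⟨ρ, hρ, hρX⟩ := exists_chart_extension (Y := Y) hX q₀
  set Θ : V → 𝓑 × Y := fun v => (extChartAt I x₀ v.1.proj, ρ (e v.1).2) with hΘ_def
  have hval : ContMDiffAt (I.prod 𝓘(ℝ, Y)) (I.prod 𝓘(ℝ, Z)) ∞
      (Subtype.val : V → TotalSpace Z E) v₀ :=
    hV.contMDiff v₀
  have hsnd : ContMDiffAt (I.prod 𝓘(ℝ, Y)) 𝓘(ℝ, Z) ∞ (fun v : V => (e v.1).2) v₀ :=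
    (contMDiffAt_trivialization_snd he (e.mem_source.2 hv₀)).comp v₀ hval
  have hΘ : ContMDiffAt (I.prod 𝓘(ℝ, Y)) 𝓘(ℝ, 𝓑 × Y) ∞ Θ v₀ :=
    ((contMDiffAt_chart_proj (mem_extChartAt_source x₀)).comp v₀ hval).prodMk_space
      (hρ.contMDiffAt.comp v₀ hsnd)
  have hcont : Tendsto (fun v : V => v.1) (𝓝 v₀) (𝓝 v₀.1) := hval.continuousAt
  have hproj := hcont.eventually (eventually_proj_mem (I := I) v₀.1 hv₀)
  have hsndX : Tendsto (fun v : V => (e v.1).2) (𝓝 v₀) (𝓝[X] (q₀ : Z)) :=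
    tendsto_nhdsWithin_iff.2 ⟨hsnd.continuousAt, hproj.mono fun v hv => hXmem v hv.2⟩
  have hρ' : ∀ᶠ z in 𝓝[X] (q₀ : Z), localParam q₀ (ρ z) = z := by
    rw [← map_nhds_subtype_val, eventually_map]
    filter_upwards [hρX, extChartAt_source_mem_nhds (I := 𝓘(ℝ, Y)) q₀] with r hr hrs
    rw [hr]
    exact congrArg Subtype.val ((extChartAt 𝓘(ℝ, Y) q₀).left_inv hrs)
  have hloc : ∀ᶠ v in 𝓝 v₀, localParam q₀ (Θ v).2 = (e v.1).2 := hsndX.eventually hρ'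
  have hΘ₀ : Θ v₀ = (extChartAt I x₀ x₀, extChartAt 𝓘(ℝ, Y) q₀ q₀) :=
    Prod.ext rfl hρX.self_of_nhds
  have hΘS : ∀ v, Θ v ∈ range I ×ˢ (univ : Set Y) := fun v => ⟨mem_range_self _, trivial⟩
  have hφ : ∀ᶠ y in 𝓝 (extChartAt 𝓘(ℝ, Y) q₀ q₀), ContDiffAt ℝ 1 (localParam q₀ : Y → Z) y :=
    ((contDiffAt_localParam (Y := Y) hX q₀).of_le (by decide)).eventually (by decide)
  have hφΘ : ∀ᶠ v in 𝓝 v₀, ContDiffAt ℝ 1 (localParam q₀ : Y → Z) (Θ v).2 := by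
    have h1 : Tendsto (fun v => (Θ v).2) (𝓝 v₀) (𝓝 (extChartAt 𝓘(ℝ, Y) q₀ q₀)) := by
      have h2 := hΘ.continuousAt.tendsto
      rw [hΘ₀] at h2
      exact (continuous_snd.tendsto _).comp h2
    exact h1.eventually hφ
  have hΘ2 : ∀ᶠ v in 𝓝 v₀, ContMDiffAt (I.prod 𝓘(ℝ, Y)) 𝓘(ℝ, 𝓑 × Y) 2 Θ v :=
    (contMDiffAt_iff_contMDiffAt_nhds (by decide)).1 (hΘ.of_le (by decide))
  -- the inclusion of `V` factors through the coordinates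
  have hfac : ∀ᶠ v in 𝓝 v₀, (Subtype.val : V → TotalSpace Z E) =ᶠ[𝓝 v]
      (fun p : 𝓑 × Y => bundleParam I e x₀ (p.1, localParam q₀ p.2)) ∘ Θ := by
    refine eventually_eventually_nhds.2 ?_
    filter_upwards [hproj, hloc] with v hv hl
    simp only [Function.comp_apply, hl]
    simp only [hΘ_def, bundleParam, (extChartAt I x₀).left_inv hv.1]
    exact (e.symm_apply_mk_proj (e.mem_source.2 hv.2)).symm
  refine ⟨q₀, Θ, hΘS, hΘ₀, ?_⟩
  filter_upwards [hΘ2, hfac, hφΘ, hproj, hloc] with v h1 h2 h3 h4 h5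
  refine ⟨h1, ?_, h4.1, h4.2, rfl, h5⟩
  refine injective_mfderiv_of_comp (hV.injective_mfderiv v) (h1.mdifferentiableAt (by decide)) hΘS
    ?_ h2
  have h6 := (contMDiffWithinAt_bundleParam (x₀ := x₀) he (extChartAt_mem_coordDomain h4.1 h4.2)
    (localParam q₀ (Θ v).2)).mdifferentiableWithinAt (by decide)
  have h7 : DifferentiableWithinAt ℝ (fun p : 𝓑 × Y => (p.1, localParam q₀ p.2))
      (range I ×ˢ univ) (Θ v) :=
    differentiableWithinAt_fst.prodMk
      ((h3.differentiableAt (by decide)).comp (Θ v) differentiableAt_snd).differentiableWithinAt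
  exact MDifferentiableWithinAt.comp (g := bundleParam I e x₀)
    (f := fun p : 𝓑 × Y => (p.1, localParam q₀ p.2)) (u := range I ×ˢ (univ : Set Z)) (Θ v) h6
    h7.mdifferentiableWithinAt fun p hp => ⟨hp.1, trivial⟩

/-- Near every point of `V`, the scaled map is an immersion of positive scalar curvature for all
small `ε`. -/
theorem eventually_scaledMap_scalar_pos {t : B → Trivialization Z (π Z E)}
    (ht : ∀ x, IsOrthogonalTrivialization I (t x)) (hmem : ∀ x, x ∈ (t x).baseSet)
    (htV : ∀ x, t x '' (V ∩ (t x).source) = (t x).baseSet ×ˢ X)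
    (hF : IsSmoothImmersion (I.prod 𝓘(ℝ, Z)) 𝓘(ℝ, W) F)
    (hX : IsSmoothImmersion 𝓘(ℝ, Y) 𝓘(ℝ, Z) (Subtype.val : X → Z))
    (hV : IsSmoothImmersion (I.prod 𝓘(ℝ, Y)) (I.prod 𝓘(ℝ, Z)) (Subtype.val : V → TotalSpace Z E))
    (hscal : HasPositiveInducedScal 𝓘(ℝ, Y) (Subtype.val : X → Z)) (v₀ : V) :
    ∀ᶠ p : ℝ × V in 𝓝[>] 0 ×ˢ 𝓝 v₀,
      Function.Injective (mfderiv (I.prod 𝓘(ℝ, Y)) 𝓘(ℝ, W) (fun v : V => scaledMap I F t p.1 v.1)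
        p.2) ∧
      0 < scalarCurvature (I.prod 𝓘(ℝ, Y))
        (inducedMetric (I.prod 𝓘(ℝ, Y)) (fun v : V => scaledMap I F t p.1 v.1)) p.2 := by
  set x₀ := v₀.1.proj with hx₀
  have he := ht x₀
  obtain ⟨q₀, Θ, hΘS, hΘ₀, hΘ⟩ :=
    exists_subbundle_coordinates hX hV he (htV x₀) v₀ (hmem x₀)
  have hxd : extChartAt I x₀ x₀ ∈ coordDomain I (t x₀) x₀ :=
    extChartAt_mem_coordDomain (mem_extChartAt_source x₀) (hmem x₀)
  have h1 := eventually_shrink_scalar_pos (Module.finBasis ℝ 𝓑) (Module.finBasis ℝ Y)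
    I.uniqueDiffOn (coordDomain_subset_range hxd)
    ((contDiffWithinAt_normalizedParam he hF hxd 0).of_le (by decide))
    ((contDiffAt_localParam (Y := Y) hX q₀).of_le (by decide))
    (fun a c hac => by
      simp only [fderivWithin_normalizedParam he hF hxd, map_zero] at hac
      exact (Prod.ext_iff.1 (injective_fderivWithin_comp_bundleParam he hF hxd 0 hac)).1)
    (isometry_normalizedParam he hF hxd) (injective_fderiv_localParam hX q₀)
    (jetScal_localParam_pos hX hscal q₀)
  have hcont : Tendsto Θ (𝓝 v₀) (𝓝[range I ×ˢ univ]
      (extChartAt I x₀ x₀, extChartAt 𝓘(ℝ, Y) q₀ q₀)) := by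
    have h2 := hΘ.self_of_nhds.1.continuousAt
    rw [ContinuousAt, hΘ₀] at h2
    exact tendsto_nhdsWithin_iff.2 ⟨h2, Eventually.of_forall hΘS⟩
  have h3 := (tendsto_id.prodMap hcont).eventually h1
  have h4 := (tendsto_snd (f := 𝓝[>] (0 : ℝ)) (g := 𝓝 v₀)).eventually
    (eventually_eventually_nhds.2 hΘ)
  filter_upwards [h3, h4] with p h5 h6
  obtain ⟨ε, v⟩ := p
  simp only [Prod.map_apply, id] at h5 h6
  obtain ⟨h7, h8, h9⟩ := h5
  obtain ⟨h10, h11, -⟩ := h6.self_of_nhds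
  have h12 : (fun v : V => scaledMap I F t ε v.1) =ᶠ[𝓝 v]
      (normalizedParam I F (t x₀) x₀ ∘ shrink (localParam q₀) ε) ∘ Θ := by
    filter_upwards [h6] with u hu
    obtain ⟨-, -, h13, h14, h15, h16⟩ := hu
    rw [scaledMap_eq ht hmem he hF ε h13 h14]
    simp only [Function.comp_apply, shrink, h15, h16]
    rfl
  have h17 := scalarCurvature_eq_jetScal_of_comp
    ((contMDiff_scaledMap ht hmem hF ε).comp hV.contMDiff)
    (I.uniqueDiffOn.prod uniqueDiffOn_univ) h10 hΘS h11 h7 h8 h12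
    ((Module.finBasis ℝ 𝓑).prod (Module.finBasis ℝ Y))
  refine ⟨h17.1, ?_⟩
  exact h17.2.symm ▸ h9

/-- A fibre bundle with compact fibre over a compact space is compact. -/
lemma isCompact_of_local_product [T2Space B] [CompactSpace B] (hX : IsCompact X)
    {t : B → Trivialization Z (π Z E)} (hmem : ∀ x, x ∈ (t x).baseSet)
    (htV : ∀ x, t x '' (V ∩ (t x).source) = (t x).baseSet ×ˢ X) : IsCompact V := by
  have h1 : ∀ x : B, ∃ K ∈ 𝓝 x, K ⊆ (t x).baseSet ∧ IsCompact K := fun x => by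
    obtain ⟨K, hK, hKs, hKc⟩ := local_compact_nhds ((t x).open_baseSet.mem_nhds (hmem x))
    exact ⟨K, hK, hKs, hKc⟩
  choose K hK hKs hKc using h1
  obtain ⟨s, hs⟩ := finite_cover_nhds hK
  have h2 : V = ⋃ x ∈ s, (t x).toOpenPartialHomeomorph.symm '' (K x ×ˢ X) := by
    ext v
    simp only [mem_iUnion]
    constructor
    · intro hv
      have h3 : v.proj ∈ ⋃ x ∈ s, K x := hs ▸ mem_univ _
      simp only [mem_iUnion] at h3
      obtain ⟨x, hx, hvx⟩ := h3
      have hvs : v ∈ (t x).source := (t x).mem_source.2 (hKs x hvx)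
      have h4 : t x v ∈ (t x).baseSet ×ˢ X := htV x ▸ mem_image_of_mem _ ⟨hv, hvs⟩
      refine ⟨x, hx, t x v, ⟨?_, h4.2⟩, (t x).left_inv hvs⟩
      rwa [(t x).coe_fst hvs]
    · rintro ⟨x, hx, p, hp, rfl⟩
      have h3 : p ∈ t x '' (V ∩ (t x).source) := htV x ▸ ⟨hKs x hp.1, hp.2⟩
      obtain ⟨v, hv, rfl⟩ := h3
      exact ((t x).left_inv hv.2).symm ▸ hv.1
  rw [h2]
  refine s.isCompact_biUnion fun x _ => ((hKc x).prod hX).image_of_continuousOn ?_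
  exact (t x).toOpenPartialHomeomorph.continuousOn_symm.mono fun p hp =>
    (t x).mem_target.2 (hKs x hp.1)

/-- The scaled map is a scalar positive immersion of `V` for some `ε`, by compactness of `V`. -/
theorem exists_scalarPositiveImmersion [T2Space B] [CompactSpace B] (hXc : IsCompact X)
    (hX : IsSmoothImmersion 𝓘(ℝ, Y) 𝓘(ℝ, Z) (Subtype.val : X → Z))
    (hVX : IsSubFibreBundle I V X)
    (hV : IsSmoothImmersion (I.prod 𝓘(ℝ, Y)) (I.prod 𝓘(ℝ, Z)) (Subtype.val : V → TotalSpace Z E))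
    (hscal : HasPositiveInducedScal 𝓘(ℝ, Y) (Subtype.val : X → Z))
    (hF : IsSmoothImmersion (I.prod 𝓘(ℝ, Z)) 𝓘(ℝ, W) F) :
    ∃ f : V → W, IsScalarPositiveImmersion (I.prod 𝓘(ℝ, Y)) f := by
  choose t hmem ht htV using hVX
  have : CompactSpace V := isCompact_iff_compactSpace.1 (isCompact_of_local_product hXc hmem htV)
  have h1 := eventually_scaledMap_scalar_pos ht hmem htV hF hX hV hscal
  have h2 : ∀ᶠ ε : ℝ in 𝓝[>] 0, ∀ v : V,
      Function.Injective (mfderiv (I.prod 𝓘(ℝ, Y)) 𝓘(ℝ, W) (fun v : V => scaledMap I F t ε v.1) v) ∧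
      0 < scalarCurvature (I.prod 𝓘(ℝ, Y))
        (inducedMetric (I.prod 𝓘(ℝ, Y)) (fun v : V => scaledMap I F t ε v.1)) v := by
    have h3 := isCompact_univ.mem_prod_nhdsSet_of_forall fun v _ => h1 v
    rw [nhdsSet_univ, mem_prod_top] at h3
    exact h3
  obtain ⟨ε, hε⟩ := h2.exists
  exact ⟨fun v => scaledMap I F t ε v.1,
    ⟨(contMDiff_scaledMap ht hmem hF ε).comp hV.contMDiff, fun v => (hε v).1⟩, fun v => (hε v).2⟩

end ScaledImmersion

end

theorem mainTheorem5 (l m k N : ℕ)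
    -- the compact base manifold, possibly with boundary
    {H : Type*} [TopologicalSpace H] (I : ModelWithCorners ℝ (EuclideanSpace ℝ (Fin l)) H)
    {B : Type*} [TopologicalSpace B] [ChartedSpace H B] [IsManifold I ∞ B]
    [T2Space B] [CompactSpace B]
    -- the Euclidean vector bundle of rank `m`
    {E : B → Type*} [TopologicalSpace (TotalSpace (EuclideanSpace ℝ (Fin m)) E)]
    [∀ x, NormedAddCommGroup (E x)] [∀ x, InnerProductSpace ℝ (E x)]
    [FiberBundle (EuclideanSpace ℝ (Fin m)) E] [VectorBundle ℝ (EuclideanSpace ℝ (Fin m)) E]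
    [ContMDiffVectorBundle ∞ (EuclideanSpace ℝ (Fin m)) E I]
    [IsContMDiffRiemannianBundle I ∞ (EuclideanSpace ℝ (Fin m)) E]
    -- the compact `k`-dimensional submanifold `X` of `ℝᵐ`
    (X : Set (EuclideanSpace ℝ (Fin m))) (hXc : IsCompact X)
    [ChartedSpace (EuclideanSpace ℝ (Fin k)) X] [IsManifold (𝓡 k) ∞ X]
    (hX : IsSmoothImmersion (𝓡 k) (𝓡 m) (Subtype.val : X → EuclideanSpace ℝ (Fin m)))
    -- the sub-fibre bundle `V` of `E` with fibre `X`, a submanifold of the total space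
    (V : Set (TotalSpace (EuclideanSpace ℝ (Fin m)) E)) (hVX : IsSubFibreBundle I V X)
    [ChartedSpace (ModelProd H (EuclideanSpace ℝ (Fin k))) V] [IsManifold (I.prod (𝓡 k)) ∞ V]
    (hV : IsSmoothImmersion (I.prod (𝓡 k)) (I.prod (𝓡 m))
      (Subtype.val : V → TotalSpace (EuclideanSpace ℝ (Fin m)) E))
    -- the metric induced on `X` has positive scalar curvature
    (hscal : HasPositiveInducedScal (𝓡 k) (Subtype.val : X → EuclideanSpace ℝ (Fin m)))
    -- the total space immerses into `ℝᴺ`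
    (hF : ∃ F : TotalSpace (EuclideanSpace ℝ (Fin m)) E → EuclideanSpace ℝ (Fin N),
      IsSmoothImmersion (I.prod (𝓡 m)) (𝓡 N) F) :
    ∃ f : V → EuclideanSpace ℝ (Fin N), IsScalarPositiveImmersion (I.prod (𝓡 k)) f := by
  obtain ⟨F, hF⟩ := hF
  exact exists_scalarPositiveImmersion hXc hX hVX hV hscal hF
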